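/- Let $N\ge 1$ and $n\ge 1$ be integers. Let $\Sigma_N$ be the space of $N\times N$ complex Hermitian matrices, with the Gaussian probability measure $$d\mu(H)=C_N\,e^{-\frac N2\operatorname{tr}(HH^\dagger)}\,dH,\qquad dH=\prod_{i=1}^N dH_{ii}\prod_{1\le i<j\le N}d^2H_{ij},\qquad \int_{\Sigma_N}d\mu(H)=1 .$$ For a partition $\lambda$ and a complex $N\times N$ matrix $A$ with eigenvalues $a_1,\dots,a_N$ (listed with algebraic multiplicity), let $s_\lambda(A)=s_\lambda(a_1,\dots,a_N)$ be the Schur polynomial evaluated at the eigenvalues, and let $\langle s_\lambda(H)\rangle=\int_{\Sigma_N}s_\lambda(H)\,d\mu(H)$. Then, for every partition $\lambda$, the functions $s_\lambda(H)$ and $s_\lambda(H_1\cdots H_n)$ are integrable with respect to $\mu$ on $\Sigma_N$ and $\mu^{\otimes n}$ on $\Sigma_N^{\times n}$ respectively, and $$\int_{\Sigma_N^{\times n}}s_\lambda(H_1H_2\cdots H_n)\prod_{i=1}^n d\mu(H_i)=\bigl(s_\lambda(I_N)\bigr)^{1-n}\,\langle s_\lambda(H)\rangle^{\,n}.$$ (If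 $\lambda$ has more than $N$ parts, then $s_\lambda$ vanishes on all $N\times N$ matrices; both sides are then $0$, the right-hand side being read as $0$.) -/

import Mathlib

open MeasureTheory Matrix

noncomputable section

namespace HermitianProduct

/-! ### Schur functions of a matrix -/

/-- The Schur polynomial `s_λ(x_1, …, x_N)`, as the determinant
`det (h_{λ_i - i + j})_{i, j = 1, …, ℓ(λ)}` of complete homogeneous symmetric polynomials
(with `h_k = 0` for `k < 0`). Here `ℓ(λ) = lam.colLen 0` is the number of rows of the
diagram and `lam.rowLen i` is its `i`-th part (counted from zero). -/
def schurPoly (N : ℕ) (lam : YoungDiagram) : MvPolynomial (Fin N) ℂ :=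
  Matrix.det (Matrix.of fun i j : Fin (lam.colLen 0) =>
    if (i : ℕ) ≤ lam.rowLen i + j then
      MvPolynomial.hsymm (Fin N) ℂ (lam.rowLen i + j - i)
    else 0)

/-- The eigenvalues of a complex `N × N` matrix, listed with algebraic multiplicity
(the order is irrelevant below, since only symmetric polynomials are evaluated on them). -/
def eigenvalueList {N : ℕ} (A : Matrix (Fin N) (Fin N) ℂ) : Fin N → ℂ :=
  fun i => A.charpoly.roots.toList.getD i 0

/-- `s_λ(A)`: the Schur polynomial evaluated at the eigenvalues of `A`. -/
def schur {N : ℕ} (lam : YoungDiagram) (A : Matrix (Fin N) (Fin N) ℂ) : ℂ :=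
  MvPolynomial.eval (eigenvalueList A) (schurPoly N lam)

/-- `eigenvalueList A` lists every root of the characteristic polynomial exactly as often as
its multiplicity. -/
theorem map_eigenvalueList {N : ℕ} (A : Matrix (Fin N) (Fin N) ℂ) :
    (Finset.univ : Finset (Fin N)).val.map (eigenvalueList A) = A.charpoly.roots := by
  have hlen : A.charpoly.roots.toList.length = N := by
    rw [Multiset.length_toList, ← (IsAlgClosed.splits A.charpoly).natDegree_eq_card_roots,
      Matrix.charpoly_natDegree_eq_dim, Fintype.card_fin]
  conv_rhs => rw [← Multiset.coe_toList A.charpoly.roots]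
  rw [Fin.univ_val_map, Multiset.coe_eq_coe]
  refine List.Perm.of_eq (List.ext_getElem (by simp [hlen]) ?_)
  intro i h1 h2
  simp [eigenvalueList, List.getElem?_eq_getElem h2]

/-! ### The Gaussian measure on Hermitian matrices -/

/-- The space `Σ_N` of `N × N` complex Hermitian matrices. -/
abbrev HermMat (N : ℕ) : Type := selfAdjoint (Matrix (Fin N) (Fin N) ℂ)

instance (N : ℕ) : MeasurableSpace (HermMat N) := borel _

instance (N : ℕ) : BorelSpace (HermMat N) := ⟨rfl⟩

/-- Independent coordinates on `Σ_N`: the real diagonal entries `H_{ii}` and the complex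
entries `H_{ij}` with `i < j`. -/
abbrev HermCoord (N : ℕ) : Type :=
  (Fin N → ℝ) × ({p : Fin N × Fin N // p.1 < p.2} → ℂ)

/-- The matrix with the given diagonal and strictly upper triangular entries, completed by
`H_{ji} = conj H_{ij}`. -/
def coordMatrix {N : ℕ} (c : HermCoord N) : Matrix (Fin N) (Fin N) ℂ :=
  Matrix.of fun i j =>
    if h : i < j then c.2 ⟨(i, j), h⟩
    else if h' : j < i then star (c.2 ⟨(j, i), h'⟩)
    else (c.1 i : ℂ)

theorem coordMatrix_mem {N : ℕ} (c : HermCoord N) :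
    coordMatrix c ∈ selfAdjoint (Matrix (Fin N) (Fin N) ℂ) := by
  rw [selfAdjoint.mem_iff]
  ext i j
  rw [Matrix.star_apply]
  rcases lt_trichotomy i j with h | h | h
  · simp [coordMatrix, h, h.not_gt]
  · subst h
    simp [coordMatrix]
  · simp [coordMatrix, h, h.not_gt]

/-- The Hermitian matrix with given coordinates. -/
def ofCoord {N : ℕ} (c : HermCoord N) : HermMat N := ⟨coordMatrix c, coordMatrix_mem c⟩

theorem measurable_ofCoord {N : ℕ} : Measurable (ofCoord (N := N)) := by
  refine Continuous.measurable (Continuous.subtype_mk ?_ _)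
  refine continuous_matrix fun i j => ?_
  simp only [coordMatrix, Matrix.of_apply]
  split_ifs <;> fun_prop

/-- The flat measure `dH = ∏_i dH_{ii} ∏_{i<j} d²H_{ij}` on `Σ_N`, where `d²` is Lebesgue
measure on `ℂ`. -/
def flatMeasure (N : ℕ) : Measure (HermMat N) :=
  (volume : Measure (HermCoord N)).map ofCoord

/-- The Gaussian probability measure `dμ(H) = C_N exp(-(N/2) tr(H H†)) dH`; `Measure.tilted`
supplies the constant `C_N` which makes the total mass one. -/
def gue (N : ℕ) : Measure (HermMat N) :=
  (flatMeasure N).tilted fun H =>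
    -((N : ℝ) / 2) * (Matrix.trace ((H : Matrix (Fin N) (Fin N) ℂ) * (H : Matrix _ _ ℂ)ᴴ)).re

/-- The total mass of the Gaussian measure is one. -/
instance isProbabilityMeasure_gue (N : ℕ) : IsProbabilityMeasure (gue N) := by
  have hne : NeZero (flatMeasure N) := ⟨by
    rw [flatMeasure, Ne, Measure.map_eq_zero_iff measurable_ofCoord.aemeasurable]
    rw [Measure.volume_eq_prod, ← Measure.measure_univ_eq_zero, ← Set.univ_prod_univ,
      Measure.prod_prod, mul_eq_zero, not_or]
    exact ⟨NeZero.ne _, NeZero.ne _⟩⟩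
  refine isProbabilityMeasure_tilted ?_
  have hcont : Continuous fun H : HermMat N => Real.exp (-((N : ℝ) / 2) *
      (Matrix.trace ((H : Matrix (Fin N) (Fin N) ℂ) * (H : Matrix _ _ ℂ)ᴴ)).re) := by
    have h : Continuous fun H : HermMat N =>
        ((H : Matrix (Fin N) (Fin N) ℂ) * (H : Matrix _ _ ℂ)ᴴ) :=
      continuous_subtype_val.mul continuous_subtype_val.matrix_conjTranspose
    exact Real.continuous_exp.comp
      (continuous_const.mul (Complex.continuous_re.comp h.matrix_trace))
  rw [flatMeasure, integrable_map_measure hcont.measurable.aestronglyMeasurable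
    measurable_ofCoord.aemeasurable]
  have key : ∀ c : HermCoord N, ∑ i, c.1 i ^ 2 + ∑ p, ‖c.2 p‖ ^ 2 ≤
      (Matrix.trace (coordMatrix c * (coordMatrix c)ᴴ)).re := by
    intro c
    have h1 : (Matrix.trace (coordMatrix c * (coordMatrix c)ᴴ)).re =
        ∑ q : Fin N × Fin N, ‖coordMatrix c q.1 q.2‖ ^ 2 := by
      rw [Fintype.sum_prod_type]
      simp only [Matrix.trace, Matrix.diag, Matrix.mul_apply, Matrix.conjTranspose_apply,
        Complex.re_sum]
      refine Finset.sum_congr rfl fun i _ => Finset.sum_congr rfl fun j _ => ?_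
      rw [← Complex.normSq_eq_norm_sq, ← Complex.ofReal_re (Complex.normSq _),
        ← Complex.mul_conj]
      rfl
    rw [h1, ← Finset.sum_filter_add_sum_filter_not Finset.univ
      (fun q : Fin N × Fin N => q.1 < q.2), add_comm]
    refine add_le_add (le_of_eq ?_) ?_
    · rw [← Finset.sum_subtype_eq_sum_filter, Finset.subtype_univ]
      refine Finset.sum_congr rfl fun p _ => ?_
      simp [coordMatrix, p.2]
    · have hinj : Function.Injective fun i : Fin N => (i, i) := fun i j h => (Prod.ext_iff.1 h).1
      calc ∑ i, c.1 i ^ 2 = ∑ q ∈ Finset.univ.map ⟨fun i : Fin N => (i, i), hinj⟩,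
            ‖coordMatrix c q.1 q.2‖ ^ 2 := by
            simp [coordMatrix]
        _ ≤ _ := by
            refine Finset.sum_le_sum_of_subset_of_nonneg ?_ fun _ _ _ => by positivity
            intro q hq
            obtain ⟨i, -, rfl⟩ := Finset.mem_map.1 hq
            simp
  rcases Nat.eq_zero_or_pos N with rfl | hN
  · have : IsFiniteMeasure (volume : Measure (HermCoord 0)) := by
      refine ⟨?_⟩
      rw [Measure.volume_eq_prod, ← Set.univ_prod_univ, Measure.prod_prod]
      simp [volume_pi]
    simp
  have hb : (0 : ℝ) < (N : ℝ) / 2 := by positivity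
  have hr : Integrable (fun x : Fin N → ℝ => ∏ i, Real.exp (-((N : ℝ) / 2) * x i ^ 2)) :=
    Integrable.fintype_prod (f := fun _ x => Real.exp (-((N : ℝ) / 2) * x ^ 2))
      fun _ => integrable_exp_neg_mul_sq hb
  have hc : Integrable (fun z : {p : Fin N × Fin N // p.1 < p.2} → ℂ =>
      ∏ p, Real.exp (-((N : ℝ) / 2) * ‖z p‖ ^ 2)) :=
    Integrable.fintype_prod (f := fun _ z => Real.exp (-((N : ℝ) / 2) * ‖z‖ ^ 2))
      fun _ => by
        have h := (GaussianFourier.integrable_cexp_neg_mul_sq_norm_add (V := ℂ)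
          (b := (((N : ℝ) / 2 : ℝ) : ℂ)) (by simpa using hN) 0 0).norm
        refine h.congr (Filter.Eventually.of_forall fun z => ?_)
        simp only [Complex.norm_exp, zero_mul, add_zero]
        rw [← Complex.ofReal_neg, ← Complex.ofReal_pow, ← Complex.ofReal_mul,
          Complex.ofReal_re]
  refine (hr.mul_prod hc).mono' (hcont.measurable.comp
    measurable_ofCoord).aestronglyMeasurable (Filter.Eventually.of_forall fun c => ?_)
  rw [Function.comp_apply, Real.norm_of_nonneg (Real.exp_pos _).le, ← Real.exp_sum, ← Real.exp_sum, ← Real.exp_add,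
    ← Finset.mul_sum, ← Finset.mul_sum, ← mul_add]
  refine Real.exp_le_exp.2 ?_
  have := mul_le_mul_of_nonneg_left (key c) hb.le
  simp only [ofCoord] at this ⊢
  linarith

/-- The ordered product `H_1 H_2 ⋯ H_n`. -/
def orderedProd {N n : ℕ} (H : Fin n → HermMat N) : Matrix (Fin N) (Fin N) ℂ :=
  (List.ofFn fun i => (H i : Matrix (Fin N) (Fin N) ℂ)).prod

end HermitianProduct

end

/-!
The identity follows once averaging over a single factor is known to act on Schur functions as a
scalar: there is a constant `t = t(λ)` with `∫ s_λ(A H) dμ(H) = t * s_λ(A)` for every matrix `A`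
(`exists_integral_schur_mul`). Integrating out `H_1, …, H_n` one at a time gives
`∫ s_λ(H_1 ⋯ H_n) = t ^ n * s_λ(1)`, while `A = 1` gives `⟨s_λ⟩ = t * s_λ(1)`
(`integral_schur_mul_orderedProd`, `pow_mul_eq_zpow_mul`).

The scalar action is obtained without the representation theory of the unitary group. Let `h_d` be
the complete homogeneous symmetric functions, and consider the degree `d` part `h_d(x_i b_j)` of the
Cauchy kernel `∏ (1 - x_i b_j)⁻¹`, where `x` and `b` are the eigenvalues of `A` and `B`. These
products are the eigenvalues of `A ⊗ B`, so `d! * h_d(x_i b_j)` is the `d`-th moment of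
`z† (A ⊗ B) z` for a complex Gaussian vector `z` (`integral_sesq_pow`: by Wick's rule these moments
satisfy Newton's identities). Arrange `z` as a matrix `Z`. Replacing `A` by `A H`, or `B` by `B H`,
turns the quadratic form into `tr (H X)` and `tr (H Y)` respectively, where `X` and `Y` depend on
`A`, `B`, `Z` and `tr (X ^ 2) = tr (Y ^ 2)`. The moments of `tr (H X)` depend on `X` only through
`tr (X ^ 2)` (`integral_trace_pow_congr`, again by integration by parts), so the averaged Cauchy
kernels of `(A H, B)` and `(A, B H)` coincide (`integral_hs_mul_comm`).

Expanding in `b`, this says that the averages `p_a(x)` of `h_{a_1} ⋯ h_{a_N}` at the eigenvalues of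
`A H` depend on the eigenvalues `x` of `A` only, are symmetric polynomials in `x`, and satisfy
`[x ^ b] p_a = [x ^ a] p_b`. The products `h_a = h_{a_1} ⋯ h_{a_N}` have the same properties. By the
Jacobi–Trudi formula `s_ν` is the alternating sum `altSum h ν`, so its average is `altSum p ν`. The
leading exponent of `s_ν` is `ν`, and averaging does not raise exponents: the elementary symmetric
functions of `diag(x) H` are sums of principal minors, with the same exponents in `x` as the
elementary symmetric polynomials (`exists_lexLE_integral`). Hence the matrix of the averaging operator
between Schur functions is triangular and symmetric, so it is diagonal
(`altCoeff_altSum_of_ne`, `exists_altSum_eq_C_mul`).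

Integrability holds because `s_λ` is a polynomial in the entries of its argument, bounded by a power
of a submultiplicative size of the matrix.
-/

noncomputable section

namespace HermitianProduct

/-! ### Complete homogeneous symmetric polynomials -/

section CompleteHomogeneous

variable {ι κ : Type*} [Fintype ι] [Fintype κ] [DecidableEq ι] [DecidableEq κ]

/-- The value `h_d(x)` of the complete homogeneous symmetric polynomial at the point `x`. -/
def hs (x : ι → ℂ) (d : ℕ) : ℂ := MvPolynomial.eval x (MvPolynomial.hsymm ι ℂ d)

/-- The geometric series `∑ n, z ^ n X ^ n`. -/
def geom (z : ℂ) : PowerSeries ℂ := PowerSeries.mk fun n => z ^ n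

theorem geom_mul (z : ℂ) : geom z * (1 - PowerSeries.C z * PowerSeries.X) = 1 := by
  ext n
  rw [mul_sub, mul_one, ← mul_assoc, map_sub]
  cases n with
  | zero => simp [geom]
  | succ n =>
    rw [PowerSeries.coeff_succ_mul_X, PowerSeries.coeff_mul_C]
    simp [geom, pow_succ]

theorem hs_eq_sum (x : ι → ℂ) (d : ℕ) :
    hs x d = ∑ a ∈ Finset.univ.finsuppAntidiag d, ∏ i, x i ^ a i := by
  rw [hs, MvPolynomial.hsymm, map_sum]
  -- a multiset of size `d` is the same as an exponent of total degree `d`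
  refine Finset.sum_bij (fun s _ => Multiset.toFinsupp s.1) ?_ ?_ ?_ ?_
  · intro s _
    rw [Finset.mem_finsuppAntidiag]
    refine ⟨?_, Finset.subset_univ _⟩
    calc ∑ i, Multiset.toFinsupp s.1 i = ∑ i, s.1.count i := by simp
      _ = s.1.card := Multiset.sum_count_eq_card fun i _ => Finset.mem_univ i
      _ = d := s.2
  · intro s _ t _ h
    exact Subtype.ext (Multiset.toFinsupp.injective h)
  · intro a ha
    rw [Finset.mem_finsuppAntidiag] at ha
    refine ⟨⟨Multiset.toFinsupp.symm a, ?_⟩, Finset.mem_univ _, by simp⟩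
    rw [← ha.1, ← Multiset.sum_count_eq_card (s := Finset.univ) fun i _ => Finset.mem_univ i]
    simp
  · intro s _
    rw [map_multiset_prod, Multiset.map_map]
    simp only [Function.comp_def, MvPolynomial.eval_X]
    rw [Finset.prod_multiset_map_count]
    simp only [Multiset.toFinsupp_apply]
    refine Finset.prod_subset (Finset.subset_univ _) fun i _ hi => ?_
    rw [Multiset.mem_toFinset] at hi
    rw [Multiset.count_eq_zero_of_notMem hi, pow_zero]

/-- The generating function of the complete homogeneous symmetric polynomials. -/
theorem mk_hs (x : ι → ℂ) : PowerSeries.mk (hs x) = ∏ i, geom (x i) := by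
  ext d
  rw [PowerSeries.coeff_mk, hs_eq_sum, PowerSeries.coeff_prod]
  simp [geom]

theorem mk_hs_mul (x : ι → ℂ) :
    PowerSeries.mk (hs x) * ∏ i, (1 - PowerSeries.C (x i) * PowerSeries.X) = 1 := by
  rw [mk_hs, ← Finset.prod_mul_distrib]
  exact Finset.prod_eq_one fun i _ => geom_mul _

theorem derivative_geom (z : ℂ) :
    PowerSeries.derivative ℂ (geom z) = PowerSeries.C z * geom z * geom z := by
  have h : geom z = 1 + PowerSeries.C z * PowerSeries.X * geom z := by
    linear_combination geom_mul z
  have h2 := congrArg (PowerSeries.derivative ℂ) h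
  simp only [map_add, Derivation.leibniz, PowerSeries.derivative_C,
    PowerSeries.derivative_X, smul_eq_mul, Derivation.map_one_eq_zero] at h2
  have h3 : PowerSeries.derivative ℂ (geom z) * (1 - PowerSeries.C z * PowerSeries.X) =
      PowerSeries.C z * geom z := by linear_combination h2
  calc PowerSeries.derivative ℂ (geom z)
      = PowerSeries.derivative ℂ (geom z) * (1 - PowerSeries.C z * PowerSeries.X) * geom z := by
        linear_combination -PowerSeries.derivative ℂ (geom z) * geom_mul z
    _ = _ := by rw [h3]

theorem derivative_prod_geom {ι : Type*} [DecidableEq ι] (x : ι → ℂ) (s : Finset ι) :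
    PowerSeries.derivative ℂ (∏ i ∈ s, geom (x i)) =
      (∑ i ∈ s, PowerSeries.C (x i) * geom (x i)) * ∏ i ∈ s, geom (x i) := by
  induction s using Finset.induction_on with
  | empty => simp [Derivation.map_one_eq_zero]
  | insert i s hi ih =>
    rw [Finset.prod_insert hi, Finset.sum_insert hi, Derivation.leibniz, ih, derivative_geom]
    simp only [smul_eq_mul]
    ring

/-- Newton's identities for the complete homogeneous symmetric polynomials. -/
theorem hs_newton (x : ι → ℂ) (d : ℕ) :
    ((d : ℂ) + 1) * hs x (d + 1) =
      ∑ p ∈ Finset.HasAntidiagonal.antidiagonal d, (∑ i, x i ^ (p.1 + 1)) * hs x p.2 := by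
  have h := derivative_prod_geom x Finset.univ
  rw [← mk_hs] at h
  have h2 := congrArg (PowerSeries.coeff d) h
  rw [PowerSeries.coeff_derivative, PowerSeries.coeff_mul, PowerSeries.coeff_mk] at h2
  rw [mul_comm, h2]
  refine Finset.sum_congr rfl fun p _ => ?_
  rw [map_sum, PowerSeries.coeff_mk]
  congr 1
  refine Finset.sum_congr rfl fun i _ => ?_
  rw [PowerSeries.coeff_C_mul, geom, PowerSeries.coeff_mk, pow_succ, mul_comm]

theorem hs_zero (x : ι → ℂ) : hs x 0 = 1 := by simp [hs]

/-- A sequence which satisfies Newton's identities with the power sums of `x` is the sequence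
of complete homogeneous symmetric polynomials of `x`. -/
theorem eq_hs_of_newton (x : ι → ℂ) (u : ℕ → ℂ) (h0 : u 0 = 1)
    (h : ∀ d : ℕ, ((d : ℂ) + 1) * u (d + 1) =
      ∑ p ∈ Finset.HasAntidiagonal.antidiagonal d, (∑ i, x i ^ (p.1 + 1)) * u p.2) (d : ℕ) :
    u d = hs x d := by
  induction d using Nat.strong_induction_on with
  | _ d ih =>
    cases d with
    | zero => rw [h0, hs_zero]
    | succ d =>
      have hd : ((d : ℂ) + 1) ≠ 0 := Nat.cast_add_one_ne_zero d
      refine mul_left_cancel₀ hd ?_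
      rw [h, hs_newton]
      refine Finset.sum_congr rfl fun p hp => ?_
      rw [ih p.2 (by rw [Finset.HasAntidiagonal.mem_antidiagonal] at hp; omega)]

/-- Cauchy's expansion of `∏ (1 - x_i b_j)⁻¹` in the variables `b`. -/
theorem hs_mul_eq_sum (x : ι → ℂ) (b : κ → ℂ) (d : ℕ) :
    hs (fun p : ι × κ => x p.1 * b p.2) d =
      ∑ a ∈ Finset.univ.finsuppAntidiag d, (∏ j, hs x (a j)) * ∏ j, b j ^ a j := by
  have h : ∀ j, ∏ i, geom (x i * b j) = PowerSeries.rescale (b j) (PowerSeries.mk (hs x)) := by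
    intro j
    rw [mk_hs, map_prod]
    refine Finset.prod_congr rfl fun i _ => ?_
    ext n
    simp [geom, PowerSeries.coeff_rescale, mul_pow, mul_comm]
  have h2 := mk_hs fun p : ι × κ => x p.1 * b p.2
  rw [Fintype.prod_prod_type_right] at h2
  simp only [h] at h2
  have h3 := congrArg (PowerSeries.coeff d) h2
  rw [PowerSeries.coeff_mk, PowerSeries.coeff_prod] at h3
  rw [h3]
  refine Finset.sum_congr rfl fun a _ => ?_
  rw [← Finset.prod_mul_distrib]
  refine Finset.prod_congr rfl fun j _ => ?_
  rw [PowerSeries.coeff_rescale, PowerSeries.coeff_mk, mul_comm]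

theorem hs_comp_equiv (e : κ ≃ ι) (x : ι → ℂ) (d : ℕ) : hs (x ∘ e) d = hs x d := by
  rw [hs, hs, ← MvPolynomial.rename_hsymm κ ℂ d e, MvPolynomial.eval_rename]

end CompleteHomogeneous

/-! ### Symmetric functions of the eigenvalues -/

section Eigenvalues

variable {N : ℕ}

theorem charpoly_eq_prod (A : Matrix (Fin N) (Fin N) ℂ) :
    A.charpoly = ∏ i, (Polynomial.X - Polynomial.C (eigenvalueList A i)) := by
  have h := (IsAlgClosed.splits A.charpoly).eq_prod_roots_of_monic A.charpoly_monic
  rw [← map_eigenvalueList, Multiset.map_map] at h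
  exact h

/-- The determinant of a polynomial in `A` is the product of its values at the eigenvalues. -/
theorem det_aeval (A : Matrix (Fin N) (Fin N) ℂ) (q : Polynomial ℂ) :
    (Polynomial.aeval A q).det = ∏ i, q.eval (eigenvalueList A i) := by
  -- both sides are multiplicative in `q`, so linear factors and constants suffice
  let φ : Polynomial ℂ →* ℂ :=
    Matrix.detMonoidHom.comp (Polynomial.aeval A).toRingHom.toMonoidHom
  let ψ : Polynomial ℂ →* ℂ :=
    { toFun := fun q => ∏ i, q.eval (eigenvalueList A i)
      map_one' := by simp
      map_mul' := fun p q => by simp [Finset.prod_mul_distrib] }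
  have hC : ∀ c, φ (Polynomial.C c) = ψ (Polynomial.C c) := by
    intro c
    simp [φ, ψ, Algebra.algebraMap_eq_smul_one]
  have hX : ∀ r, φ (Polynomial.X - Polynomial.C r) = ψ (Polynomial.X - Polynomial.C r) := by
    intro r
    have h := congrArg (Polynomial.eval r) (charpoly_eq_prod A)
    rw [Matrix.eval_charpoly, Polynomial.eval_prod] at h
    have h2 : (A - Matrix.scalar (Fin N) r).det = (-1) ^ N * (Matrix.scalar (Fin N) r - A).det := by
      rw [← neg_sub, Matrix.det_neg, Fintype.card_fin]
    have h3 : φ (Polynomial.X - Polynomial.C r) = (A - Matrix.scalar (Fin N) r).det := by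
      simp [φ, Matrix.algebraMap_eq_diagonal, Pi.algebraMap_def]
    rw [h3, h2, h]
    simp only [ψ, MonoidHom.coe_mk, OneHom.coe_mk, Polynomial.eval_sub, Polynomial.eval_X,
      Polynomial.eval_C]
    calc (-1) ^ N * ∏ i, (r - eigenvalueList A i)
        = ∏ i : Fin N, (-1) * (r - eigenvalueList A i) := by
          rw [Finset.prod_mul_distrib]; simp
      _ = _ := Finset.prod_congr rfl fun i _ => by ring
  have h : φ q = ψ q := by
    rw [(IsAlgClosed.splits q).eq_prod_roots, map_mul, map_mul, hC, map_multiset_prod,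
      map_multiset_prod, Multiset.map_map, Multiset.map_map]
    congr 2
    exact Multiset.map_congr rfl fun r _ => hX r
  exact h

/-- The power sums of the eigenvalues are the traces of the powers. -/
theorem sum_eigenvalueList_pow (A : Matrix (Fin N) (Fin N) ℂ) (k : ℕ) :
    ∑ i, eigenvalueList A i ^ k = (A ^ k).trace := by
  have h : (A ^ k).charpoly =
      ∏ i, (Polynomial.X - Polynomial.C (eigenvalueList A i ^ k)) := by
    refine Polynomial.funext fun z => ?_
    -- `det (z - A ^ k)` is the determinant of a polynomial in `A`
    have h1 := det_aeval A (Polynomial.C z - Polynomial.X ^ k)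
    rw [Matrix.eval_charpoly, Polynomial.eval_prod]
    simp only [map_sub, Polynomial.aeval_C, map_pow, Polynomial.aeval_X, Polynomial.eval_sub,
      Polynomial.eval_C, Polynomial.eval_pow, Polynomial.eval_X] at h1 ⊢
    rw [← h1, Matrix.algebraMap_eq_diagonal, Matrix.scalar_apply]
    rfl
  have h2 : (A ^ k).charpoly =
      ((Finset.univ.val.map fun i => eigenvalueList A i ^ k).map
        fun r => Polynomial.X - Polynomial.C r).prod := by
    rw [h, Multiset.map_map]
    rfl
  rw [Matrix.trace_eq_sum_roots_charpoly, h2, Polynomial.roots_multiset_prod_X_sub_C]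
  rfl

/-- The power sums determine the complete homogeneous symmetric functions. The numbers of variables
need not agree. -/
theorem hs_congr {ι κ : Type*} [Fintype ι] [Fintype κ] [DecidableEq ι] [DecidableEq κ]
    {x : ι → ℂ} {y : κ → ℂ}
    (h : ∀ k, ∑ i, x i ^ (k + 1) = ∑ i, y i ^ (k + 1)) (d : ℕ) : hs x d = hs y d := by
  refine eq_hs_of_newton y (hs x) (hs_zero x) (fun d => ?_) d
  rw [hs_newton]
  simp only [h]

theorem schur_eq_det (lam : YoungDiagram) (A : Matrix (Fin N) (Fin N) ℂ) :
    schur lam A = Matrix.det (Matrix.of fun i j : Fin (lam.colLen 0) =>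
      if (i : ℕ) ≤ lam.rowLen i + j then hs (eigenvalueList A) (lam.rowLen i + j - i) else 0) := by
  rw [schur, schurPoly, RingHom.map_det]
  congr 1
  ext i j
  simp only [RingHom.mapMatrix_apply, Matrix.map_apply, Matrix.of_apply]
  split_ifs <;> simp [hs]

/-- The complete homogeneous symmetric functions of the eigenvalues are polynomials in the
entries of the matrix. -/
theorem exists_eval_eq_hs (N d : ℕ) : ∃ q : MvPolynomial (Fin N × Fin N) ℂ,
    ∀ A : Matrix (Fin N) (Fin N) ℂ,
      hs (eigenvalueList A) d = MvPolynomial.eval (fun p => A p.1 p.2) q := by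
  have htr : ∀ k, ∃ q : MvPolynomial (Fin N × Fin N) ℂ, ∀ A : Matrix (Fin N) (Fin N) ℂ,
      (A ^ k).trace = MvPolynomial.eval (fun p => A p.1 p.2) q := by
    intro k
    refine ⟨(Matrix.mvPolynomialX (Fin N) (Fin N) ℂ ^ k).trace, fun A => ?_⟩
    have h := AddMonoidHom.map_trace
      (MvPolynomial.eval (fun p : Fin N × Fin N => A p.1 p.2)).toAddMonoidHom
      (Matrix.mvPolynomialX (Fin N) (Fin N) ℂ ^ k)
    refine Eq.trans ?_ h.symm
    have h2 : (Matrix.mvPolynomialX (Fin N) (Fin N) ℂ).map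
        (MvPolynomial.eval fun p : Fin N × Fin N => A p.1 p.2) = A :=
      Matrix.mvPolynomialX_mapMatrix_eval A
    conv_lhs => rw [← h2]
    congr 1
    exact (Matrix.map_pow (Matrix.mvPolynomialX (Fin N) (Fin N) ℂ)
      (MvPolynomial.eval fun p : Fin N × Fin N => A p.1 p.2) k).symm
  choose t ht using htr
  induction d using Nat.strong_induction_on with
  | _ d ih =>
    cases d with
    | zero => exact ⟨1, fun A => by rw [hs_zero, map_one]⟩
    | succ d =>
      -- solve Newton's identity for `h_{d+1}`
      have ih' : ∀ e, ∃ q : MvPolynomial (Fin N × Fin N) ℂ, e < d + 1 →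
          ∀ A : Matrix (Fin N) (Fin N) ℂ,
            hs (eigenvalueList A) e = MvPolynomial.eval (fun p => A p.1 p.2) q := fun e => by
        by_cases he : e < d + 1
        · obtain ⟨q, hq⟩ := ih e he
          exact ⟨q, fun _ => hq⟩
        · exact ⟨0, fun h => absurd h he⟩
      choose q hq using ih'
      refine ⟨MvPolynomial.C ((d : ℂ) + 1)⁻¹ *
        ∑ p ∈ Finset.HasAntidiagonal.antidiagonal d, t (p.1 + 1) * q p.2, fun A => ?_⟩
      rw [map_mul, MvPolynomial.eval_C, eq_inv_mul_iff_mul_eq₀ (Nat.cast_add_one_ne_zero d),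
        hs_newton, map_sum]
      refine Finset.sum_congr rfl fun p hp => ?_
      rw [Finset.HasAntidiagonal.mem_antidiagonal] at hp
      rw [map_mul, ← ht, ← hq p.2 (by omega), sum_eigenvalueList_pow]

theorem exists_eval_eq_schur (N : ℕ) (lam : YoungDiagram) :
    ∃ q : MvPolynomial (Fin N × Fin N) ℂ, ∀ A : Matrix (Fin N) (Fin N) ℂ,
      schur lam A = MvPolynomial.eval (fun p => A p.1 p.2) q := by
  choose q hq using exists_eval_eq_hs N
  refine ⟨Matrix.det (Matrix.of fun i j : Fin (lam.colLen 0) =>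
      if (i : ℕ) ≤ lam.rowLen i + j then q (lam.rowLen i + j - i) else 0), fun A => ?_⟩
  rw [schur_eq_det, RingHom.map_det]
  congr 1
  ext i j
  simp only [RingHom.mapMatrix_apply, Matrix.map_apply, Matrix.of_apply]
  split_ifs <;> simp [hq]

/-- The elementary symmetric functions of the eigenvalues are the sums of principal minors. -/
theorem eval_esymm_eigenvalueList (A : Matrix (Fin N) (Fin N) ℂ) {k : ℕ} (hk : k ≤ N) :
    MvPolynomial.eval (eigenvalueList A) (MvPolynomial.esymm (Fin N) ℂ k) =
      ∑ s ∈ Finset.univ.powersetCard k,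
        (A.submatrix (Subtype.val : s → Fin N) (Subtype.val : s → Fin N)).det := by
  have h := Matrix.charpoly_coeff_eq_sum_minors A k (by simpa using hk)
  have hroots : A.charpoly = (A.charpoly.roots.map fun r => Polynomial.X - Polynomial.C r).prod :=
    (IsAlgClosed.splits A.charpoly).eq_prod_roots_of_monic A.charpoly_monic
  have hcard : A.charpoly.roots.card = N := by rw [← map_eigenvalueList]; simp
  rw [hroots, Multiset.prod_X_sub_C_coeff _ (by rw [hcard, Fintype.card_fin]; omega), hcard,
    Fintype.card_fin, Nat.sub_sub_self hk] at h
  have h2 := mul_left_cancel₀ (pow_ne_zero k (neg_ne_zero.2 one_ne_zero)) h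
  rw [← h2, ← map_eigenvalueList, ← MvPolynomial.aeval_esymm_eq_multiset_esymm (Fin N) ℂ]
  rfl

end Eigenvalues

/-! ### Lexicographic bounds on exponents -/

section Lex

variable {N : ℕ} {R : Type*} [CommRing R]

/-- Every exponent of `f` is at most `ν` in the lexicographic order. -/
def LexLE (f : MvPolynomial (Fin N) R) (ν : Fin N →₀ ℕ) : Prop :=
  ∀ β ∈ f.support, toLex β ≤ toLex ν

theorem LexLE.mono {f : MvPolynomial (Fin N) R} {ν κ : Fin N →₀ ℕ} (h : LexLE f ν)
    (hνκ : toLex ν ≤ toLex κ) : LexLE f κ := fun β hβ => (h β hβ).trans hνκ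

theorem LexLE.sum {ι : Type*} {s : Finset ι} {f : ι → MvPolynomial (Fin N) R} {ν : Fin N →₀ ℕ}
    (h : ∀ i ∈ s, LexLE (f i) ν) : LexLE (∑ i ∈ s, f i) ν := by
  intro β hβ
  obtain ⟨i, hi, hβi⟩ := Finset.mem_biUnion.1 (MvPolynomial.support_sum hβ)
  exact h i hi β hβi

theorem LexLE.mul {f g : MvPolynomial (Fin N) R} {ν κ : Fin N →₀ ℕ} (hf : LexLE f ν)
    (hg : LexLE g κ) : LexLE (f * g) (ν + κ) := by
  intro β hβ
  obtain ⟨a, ha, b, hb, rfl⟩ := Finset.mem_add.1 (MvPolynomial.support_mul f g hβ)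
  rw [toLex_add, toLex_add]
  exact add_le_add (hf a ha) (hg b hb)

theorem LexLE.C (r : R) : LexLE (N := N) (MvPolynomial.C r) 0 := by
  intro β hβ
  rw [MvPolynomial.mem_support_iff, MvPolynomial.coeff_C] at hβ
  split_ifs at hβ with h
  · rw [← h]
  · exact absurd rfl hβ

theorem LexLE.prod {ι : Type*} {s : Finset ι} {f : ι → MvPolynomial (Fin N) R}
    {ν : ι → Fin N →₀ ℕ} (h : ∀ i ∈ s, LexLE (f i) (ν i)) :
    LexLE (∏ i ∈ s, f i) (∑ i ∈ s, ν i) := by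
  classical
  induction s using Finset.induction_on with
  | empty => simpa using LexLE.C (N := N) (1 : R)
  | insert i s hi ih =>
    rw [Finset.prod_insert hi, Finset.sum_insert hi]
    exact (h i (by simp)).mul (ih fun j hj => h j (by simp [hj]))

theorem LexLE.pow {f : MvPolynomial (Fin N) R} {ν : Fin N →₀ ℕ} (hf : LexLE f ν) (n : ℕ) :
    LexLE (f ^ n) (n • ν) := by
  simpa using LexLE.prod (s := Finset.range n) (f := fun _ => f) (ν := fun _ => ν) fun _ _ => hf

/-- A tuple of natural numbers as an exponent. -/
def expo (f : Fin N → ℕ) : Fin N →₀ ℕ := Finsupp.equivFunOnFinite.symm f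

@[simp] theorem expo_apply (f : Fin N → ℕ) (i : Fin N) : expo f i = f i := rfl

/-- An antitone exponent is the lexicographically largest among its rearrangements. -/
theorem toLex_expo_comp_le {f : Fin N → ℕ} (hf : Antitone f) (w : Equiv.Perm (Fin N)) :
    toLex (expo (f ∘ w)) ≤ toLex (expo f) := by
  by_contra! h
  obtain ⟨i, hi, hlt⟩ := h
  simp only [ofLex_toLex, expo_apply, Function.comp_apply] at hi hlt
  -- count the entries which are at least `f (w i)` in the two arrangements
  have h1 : (Finset.univ.filter fun j => f (w i) ≤ f j).map w.symm.toEmbedding =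
      Finset.univ.filter fun j => f (w i) ≤ f (w j) := by
    ext j
    simp
  have h2 : (Finset.univ.filter fun j => f (w i) ≤ f j) ⊂
      Finset.univ.filter fun j => f (w i) ≤ f (w j) := by
    refine (Finset.ssubset_iff_of_subset fun j hj => ?_).2 ⟨i, by simp, by simpa using hlt⟩
    simp only [Finset.mem_filter, Finset.mem_univ, true_and] at hj ⊢
    rw [← hi j]
    · exact hj
    · by_contra! hij
      exact (hj.trans (hf hij)).not_gt hlt
  have h3 := Finset.card_lt_card h2
  rw [← h1, Finset.card_map] at h3
  exact lt_irrefl _ h3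

/-- The fundamental theorem of symmetric polynomials with control of the exponents: no cancellation
of leading terms can occur among distinct monomials in the elementary symmetric polynomials. -/
theorem exists_esymm_of_lexLE {f : MvPolynomial (Fin N) ℂ} (hf : f.IsSymmetric) {ν : Fin N →₀ ℕ}
    (hν : LexLE f ν) : ∃ Q : MvPolynomial (Fin N) ℂ,
      f = MvPolynomial.aeval (fun i : Fin N => MvPolynomial.esymm (Fin N) ℂ (i + 1)) Q ∧
      ∀ t ∈ Q.support, toLex (expo (Fin.accumulate N N t)) ≤ toLex ν := by
  obtain ⟨Q, hQ⟩ := (MvPolynomial.esymmAlgHom_fin_bijective ℂ N).2 ⟨f, hf⟩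
  have hfQ : f = (MvPolynomial.esymmAlgHom (Fin N) ℂ N Q).val := by rw [hQ]
  refine ⟨Q, by rw [hfQ, MvPolynomial.esymmAlgHom_apply], ?_⟩
  by_contra! hcon
  obtain ⟨t₁, ht₁, hlt⟩ := hcon
  -- the largest leading exponent, attained by a single monomial of `Q`, survives in `f`
  obtain ⟨t, ht, hmax⟩ := Q.support.exists_max_image
    (fun t => toLex (expo (Fin.accumulate N N t))) ⟨t₁, ht₁⟩
  have hsum : f = ∑ t ∈ Q.support,
      MvPolynomial.esymmAlgHomMonomial (Fin N) t (Q.coeff t) := by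
    rw [hfQ]
    conv_lhs => rw [Q.as_sum, map_sum, AddSubmonoidClass.coe_finsetSum]
    rfl
  have hdeg : ∀ s ∈ Q.support, AddMonoidAlgebra.supDegree toLex
      (MvPolynomial.esymmAlgHomMonomial (Fin N) s (Q.coeff s)) =
        toLex (expo (Fin.accumulate N N s)) := by
    intro s hs
    rw [← ofLex_inj, DFunLike.ext'_iff, MvPolynomial.supDegree_esymmAlgHomMonomial
      (MvPolynomial.mem_support_iff.1 hs) s le_rfl]
    rfl
  have h := AddMonoidAlgebra.supDegree_leadingCoeff_sum_eq (D := toLex) (s := Q.support) (i := t)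
    (f := fun t => MvPolynomial.esymmAlgHomMonomial (Fin N) t (Q.coeff t)) ht (by
      intro s hs hne
      rw [hdeg s hs, hdeg t ht]
      refine lt_of_le_of_ne (hmax s hs) fun he => hne ?_
      have := Fin.accumulate_injective (n := N) (m := N) le_rfl
        (congrArg (fun z : Lex (Fin N →₀ ℕ) => ⇑(ofLex z)) he)
      exact DFunLike.coe_injective this)
  rw [← hsum, hdeg t ht, MvPolynomial.leadingCoeff_esymmAlgHomMonomial t le_rfl] at h
  have hmem : expo (Fin.accumulate N N t) ∈ f.support := by
    rw [MvPolynomial.mem_support_iff]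
    have h2 : f.coeff (expo (Fin.accumulate N N t)) =
        AddMonoidAlgebra.leadingCoeff toLex f := by
      rw [MvPolynomial.leadingCoeff_toLex, h.1]
      rfl
    rw [h2, h.2]
    exact MvPolynomial.mem_support_iff.1 ht
  exact (hlt.trans_le (hmax t₁ ht₁)).not_ge (hν _ hmem)

end Lex

/-! ### Alternating sums over the symmetric group -/

section Alternating

variable {N : ℕ}

/-- The staircase exponent `(N - 1, …, 1, 0)`. -/
def stair (N : ℕ) : Fin N → ℕ := fun i => N - 1 - i

theorem stair_antitone : Antitone (stair N) := fun i j h => by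
  simp only [stair]
  have : (i : ℕ) ≤ j := h
  omega

theorem stair_injective : Function.Injective (stair N) := fun i j h => by
  simp only [stair] at h
  ext
  omega

/-- The alternating sum `∑ w, sgn w • p (ν + ρ - ρ ∘ w)`, where `ρ` is the staircase and terms with a
negative entry of the exponent are zero. -/
def altSum {M : Type*} [AddCommGroup M] (p : (Fin N →₀ ℕ) → M) (ν : Fin N →₀ ℕ) : M :=
  ∑ w : Equiv.Perm (Fin N), Equiv.Perm.sign w •
    if expo (stair N ∘ w) ≤ ν + expo (stair N) then
      p (ν + expo (stair N) - expo (stair N ∘ w)) else 0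

theorem map_altSum {M M' : Type*} [AddCommGroup M] [AddCommGroup M'] (φ : M →+ M')
    (p : (Fin N →₀ ℕ) → M) (ν : Fin N →₀ ℕ) :
    φ (altSum p ν) = altSum (fun a => φ (p a)) ν := by
  simp only [altSum, map_sum]
  refine Finset.sum_congr rfl fun w _ => ?_
  rcases Int.units_eq_one_or (Equiv.Perm.sign w) with h | h <;> rw [h] <;> split_ifs <;> simp

/-- The antisymmetrised coefficient of `P` at `κ`, i.e. the coefficient of `x ^ (κ + ρ)` in the
product of `P` with the Vandermonde polynomial. -/
def altCoeff (κ : Fin N →₀ ℕ) (P : MvPolynomial (Fin N) ℂ) : ℂ :=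
  altSum (fun β => P.coeff β) κ

theorem altCoeff_altSum (p : (Fin N →₀ ℕ) → MvPolynomial (Fin N) ℂ) (κ ν : Fin N →₀ ℕ) :
    altCoeff κ (altSum p ν) = altSum (fun β => altSum (fun a => (p a).coeff β) ν) κ := by
  rw [altCoeff]
  congr 1
  funext β
  exact map_altSum (MvPolynomial.coeffAddMonoidHom β) p ν

/-- A family with a symmetric matrix of coefficients has symmetric antisymmetrised coefficients. -/
theorem altCoeff_altSum_comm {p : (Fin N →₀ ℕ) → MvPolynomial (Fin N) ℂ}
    (hp : ∀ a b, (p a).coeff b = (p b).coeff a) (κ ν : Fin N →₀ ℕ) :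
    altCoeff κ (altSum p ν) = altCoeff ν (altSum p κ) := by
  rw [altCoeff_altSum, altCoeff_altSum]
  have key : ∀ (g : (Fin N →₀ ℕ) → (Fin N →₀ ℕ) → ℂ) (κ ν : Fin N →₀ ℕ),
      altSum (fun β => altSum (fun a => g a β) ν) κ =
        ∑ w : Equiv.Perm (Fin N), ∑ v : Equiv.Perm (Fin N),
          ((Equiv.Perm.sign w : ℤ) : ℂ) * ((Equiv.Perm.sign v : ℤ) : ℂ) *
          if expo (stair N ∘ w) ≤ κ + expo (stair N) ∧ expo (stair N ∘ v) ≤ ν + expo (stair N) then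
            g (ν + expo (stair N) - expo (stair N ∘ v)) (κ + expo (stair N) - expo (stair N ∘ w))
          else 0 := by
    intro g κ ν
    simp only [altSum, Units.smul_def, zsmul_eq_mul]
    refine Finset.sum_congr rfl fun w _ => ?_
    split_ifs with h
    · rw [Finset.mul_sum]
      refine Finset.sum_congr rfl fun v _ => ?_
      simp only [h, true_and, mul_assoc]
    · simp [h]
  rw [key, key, Finset.sum_comm]
  refine Finset.sum_congr rfl fun v _ => Finset.sum_congr rfl fun w _ => ?_
  rw [mul_comm (((Equiv.Perm.sign w : ℤ) : ℂ))]
  simp only [and_comm, hp]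

/-- No antisymmetrised coefficient lies beyond the leading exponent, since the identity permutation
gives the largest exponent of the Vandermonde polynomial. -/
theorem altCoeff_eq_zero {P : MvPolynomial (Fin N) ℂ} {ν κ : Fin N →₀ ℕ} (hP : LexLE P ν)
    (h : toLex ν < toLex κ) : altCoeff κ P = 0 := by
  refine Finset.sum_eq_zero fun w _ => ?_
  split_ifs with hw
  · have h0 : P.coeff (κ + expo (stair N) - expo (stair N ∘ w)) = 0 := by
      by_contra hne
      have h1 := hP _ (MvPolynomial.mem_support_iff.2 hne)
      have h2 := add_le_add h1 (toLex_expo_comp_le stair_antitone w)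
      rw [← toLex_add, tsub_add_cancel_of_le hw, toLex_add] at h2
      exact (le_of_add_le_add_right h2).not_gt h
    simp only [h0, smul_zero]
  · exact smul_zero _

/-- At the leading exponent, the antisymmetrised coefficient is the leading coefficient. -/
theorem altCoeff_of_max {P : MvPolynomial (Fin N) ℂ} {κ : Fin N →₀ ℕ} (hP : LexLE P κ) :
    altCoeff κ P = P.coeff κ := by
  rw [altCoeff, altSum, Finset.sum_eq_single 1]
  · simp
  · intro w _ hw
    split_ifs with hle
    · have h0 : P.coeff (κ + expo (stair N) - expo (stair N ∘ w)) = 0 := by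
        by_contra hne
        have h1 := hP _ (MvPolynomial.mem_support_iff.2 hne)
        have h2 := add_le_add h1 (le_refl (toLex (expo (stair N ∘ w))))
        rw [← toLex_add, tsub_add_cancel_of_le hle, toLex_add] at h2
        have h3 := (toLex_expo_comp_le stair_antitone w).antisymm (le_of_add_le_add_left h2)
        refine hw (Equiv.ext fun i => stair_injective ?_)
        exact DFunLike.congr_fun (toLex.injective h3) i
      simp only [h0, smul_zero]
    · exact smul_zero _
  · simp

theorem exists_max_exponent {P : MvPolynomial (Fin N) ℂ} (hP : P ≠ 0) :
    ∃ κ ∈ P.support, LexLE P κ :=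
  P.support.exists_max_image toLex (MvPolynomial.support_nonempty.2 hP)

theorem antitone_of_max {P : MvPolynomial (Fin N) ℂ} (hP : P.IsSymmetric) {κ : Fin N →₀ ℕ}
    (hκ : κ ∈ P.support) (hmax : LexLE P κ) : Antitone κ := by
  have h : AddMonoidAlgebra.supDegree toLex P = toLex κ :=
    le_antisymm (Finset.sup_le hmax) (Finset.le_sup (f := toLex) hκ)
  have h2 := hP.antitone_supDegree
  rwa [h] at h2

/-- A symmetric polynomial is determined by its antisymmetrised coefficients at antitone
exponents. -/
theorem eq_zero_of_altCoeff {P : MvPolynomial (Fin N) ℂ} (hP : P.IsSymmetric)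
    (h : ∀ κ : Fin N →₀ ℕ, Antitone κ → altCoeff κ P = 0) : P = 0 := by
  by_contra hne
  obtain ⟨κ, hκ, hmax⟩ := exists_max_exponent hne
  have h1 := h κ (antitone_of_max hP hκ hmax)
  rw [altCoeff_of_max hmax] at h1
  exact MvPolynomial.mem_support_iff.1 hκ h1

theorem altCoeff_sub (κ : Fin N →₀ ℕ) (P Q : MvPolynomial (Fin N) ℂ) :
    altCoeff κ (P - Q) = altCoeff κ P - altCoeff κ Q := by
  simp only [altCoeff, altSum, ← Finset.sum_sub_distrib]
  refine Finset.sum_congr rfl fun w _ => ?_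
  split_ifs <;> simp [smul_sub]

theorem altCoeff_C_mul (κ : Fin N →₀ ℕ) (c : ℂ) (P : MvPolynomial (Fin N) ℂ) :
    altCoeff κ (MvPolynomial.C c * P) = c * altCoeff κ P := by
  simp only [altCoeff, altSum, Finset.mul_sum]
  refine Finset.sum_congr rfl fun w _ => ?_
  split_ifs <;> simp [mul_smul_comm]

theorem altSum_isSymmetric {p : (Fin N →₀ ℕ) → MvPolynomial (Fin N) ℂ}
    (hp : ∀ a, (p a).IsSymmetric) (ν : Fin N →₀ ℕ) : (altSum p ν).IsSymmetric := by
  intro e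
  refine (map_altSum (MvPolynomial.rename e).toRingHom.toAddMonoidHom p ν).trans ?_
  exact congrArg (altSum · ν) (funext fun a => hp a e)

/-- A symmetric and triangular family of coefficients is diagonal: the antisymmetrised coefficients
of `altSum p ν` vanish away from `ν`. -/
theorem altCoeff_altSum_of_ne {p : (Fin N →₀ ℕ) → MvPolynomial (Fin N) ℂ}
    (hp : ∀ a b, (p a).coeff b = (p b).coeff a)
    (htri : ∀ ν : Fin N →₀ ℕ, Antitone ν → LexLE (altSum p ν) ν)
    {κ ν : Fin N →₀ ℕ} (hκ : Antitone κ) (hν : Antitone ν) (hne : κ ≠ ν) :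
    altCoeff κ (altSum p ν) = 0 := by
  rcases lt_or_gt_of_ne (fun h => hne (toLex.injective h) : toLex κ ≠ toLex ν) with h | h
  · rw [altCoeff_altSum_comm hp]
    exact altCoeff_eq_zero (htri κ hκ) h
  · exact altCoeff_eq_zero (htri ν hν) h

/-- Two symmetric families of symmetric polynomials with triangular alternating sums have
proportional alternating sums. -/
theorem exists_altSum_eq_C_mul {p h : (Fin N →₀ ℕ) → MvPolynomial (Fin N) ℂ}
    (hp : ∀ a b, (p a).coeff b = (p b).coeff a) (hps : ∀ a, (p a).IsSymmetric)
    (hptri : ∀ ν : Fin N →₀ ℕ, Antitone ν → LexLE (altSum p ν) ν)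
    (hh : ∀ a b, (h a).coeff b = (h b).coeff a) (hhs : ∀ a, (h a).IsSymmetric)
    (hhtri : ∀ ν : Fin N →₀ ℕ, Antitone ν → LexLE (altSum h ν) ν)
    {ν : Fin N →₀ ℕ} (hν : Antitone ν) (h0 : altSum h ν = 0 → altSum p ν = 0) :
    ∃ t : ℂ, altSum p ν = MvPolynomial.C t * altSum h ν := by
  by_cases hc : altCoeff ν (altSum h ν) = 0
  · have h1 : altSum h ν = 0 := eq_zero_of_altCoeff (altSum_isSymmetric hhs ν) fun κ hκ => by
      by_cases hne : κ = ν
      · rw [hne, hc]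
      · exact altCoeff_altSum_of_ne hh hhtri hκ hν hne
    exact ⟨0, by rw [h0 h1, h1, mul_zero]⟩
  · -- both sides have no antisymmetrised coefficient away from `ν`, and agree at `ν`
    refine ⟨altCoeff ν (altSum p ν) / altCoeff ν (altSum h ν), ?_⟩
    rw [← sub_eq_zero]
    refine eq_zero_of_altCoeff ((altSum_isSymmetric hps ν).sub
      ((MvPolynomial.IsSymmetric.C _).mul (altSum_isSymmetric hhs ν))) fun κ hκ => ?_
    rw [altCoeff_sub, altCoeff_C_mul]
    by_cases hne : κ = ν
    · rw [hne, div_mul_cancel₀ _ hc, sub_self]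
    · rw [altCoeff_altSum_of_ne hp hptri hκ hν hne, altCoeff_altSum_of_ne hh hhtri hκ hν hne,
        mul_zero, sub_zero]

end Alternating

/-! ### Jacobi–Trudi determinants -/

section JacobiTrudi

variable {N : ℕ}

/-- The product `h_{a_1} ⋯ h_{a_N}` of complete homogeneous symmetric polynomials. -/
def hPoly (a : Fin N →₀ ℕ) : MvPolynomial (Fin N) ℂ := ∏ j, MvPolynomial.hsymm (Fin N) ℂ (a j)

theorem eval_hPoly (a : Fin N →₀ ℕ) (x : Fin N → ℂ) :
    MvPolynomial.eval x (hPoly a) = ∏ j, hs x (a j) := by simp [hPoly, map_prod, hs]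

theorem hPoly_isSymmetric (a : Fin N →₀ ℕ) : (hPoly a).IsSymmetric := by
  intro e
  rw [hPoly, map_prod]
  exact Finset.prod_congr rfl fun j _ => MvPolynomial.hsymm_isSymmetric _ _ _ e

/-- The Jacobi–Trudi determinant with `N` rows in `N` variables. -/
def jacobiTrudi (x : Fin N → ℂ) (f : Fin N → ℕ) : ℂ :=
  Matrix.det (Matrix.of fun i j : Fin N =>
    if (i : ℕ) ≤ f i + j then hs x (f i + j - i) else 0)

/-- The Jacobi–Trudi determinant, expanded over permutations. The conditions for an entry to be
nonzero match the conditions for an exponent in `altSum` to be nonnegative. -/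
theorem jacobiTrudi_eq_eval (x : Fin N → ℂ) (f : Fin N → ℕ) :
    jacobiTrudi x f = MvPolynomial.eval x (altSum hPoly (expo f)) := by
  have h := map_altSum (MvPolynomial.eval x).toAddMonoidHom (hPoly (N := N)) (expo f)
  refine Eq.trans ?_ h.symm
  rw [jacobiTrudi, ← Matrix.det_transpose, Matrix.det_apply]
  refine Finset.sum_congr rfl fun w _ => ?_
  congr 1
  have hle : ∀ i : Fin N, stair N (w i) ≤ f i + stair N i ↔ (i : ℕ) ≤ f i + w i := by
    intro i
    have h1 := i.2
    have h2 := (w i).2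
    simp only [stair]
    omega
  have hiff : expo (stair N ∘ w) ≤ expo f + expo (stair N) ↔ ∀ i : Fin N, (i : ℕ) ≤ f i + w i := by
    rw [Finsupp.le_def]
    exact forall_congr' fun i => hle i
  by_cases hc : ∀ i : Fin N, (i : ℕ) ≤ f i + w i
  · rw [if_pos (hiff.2 hc)]
    refine Eq.trans ?_ (eval_hPoly _ x).symm
    refine Finset.prod_congr rfl fun i _ => ?_
    simp only [Matrix.transpose_apply, Matrix.of_apply]
    rw [if_pos (hc i)]
    congr 1
    have h1 := i.2
    have h2 := (w i).2
    have h3 := hc i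
    simp only [Finsupp.coe_tsub, Finsupp.coe_add, Pi.sub_apply, Pi.add_apply, expo_apply,
      Function.comp_apply, stair]
    omega
  · rw [if_neg (fun h => hc (hiff.1 h))]
    push Not at hc
    obtain ⟨i, hi⟩ := hc
    refine Finset.prod_eq_zero (Finset.mem_univ i) ?_
    simp only [Matrix.transpose_apply, Matrix.of_apply]
    rw [if_neg (by omega)]

/-- A product of `card s` linear factors has degree at most `card s`. -/
theorem coeff_prod_one_sub {ι : Type*} [DecidableEq ι] (x : ι → ℂ) (s : Finset ι) {r : ℕ}
    (hr : s.card < r) :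
    PowerSeries.coeff r (∏ i ∈ s, (1 - PowerSeries.C (x i) * PowerSeries.X)) = 0 := by
  induction s using Finset.induction_on generalizing r with
  | empty =>
    rw [Finset.prod_empty, PowerSeries.coeff_one, if_neg]
    rw [Finset.card_empty] at hr
    omega
  | insert i s hi ih =>
    rw [Finset.card_insert_of_notMem hi] at hr
    obtain ⟨r, rfl⟩ : ∃ k, r = k + 1 := ⟨r - 1, by omega⟩
    rw [Finset.prod_insert hi, sub_mul, one_mul, map_sub, ih (by omega), mul_assoc,
      PowerSeries.coeff_C_mul, PowerSeries.coeff_succ_X_mul, ih (by omega), mul_zero, sub_zero]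

/-- A row of a Jacobi–Trudi matrix, paired with the coefficients of a polynomial `E` of degree less
than the size of the matrix, gives a coefficient of the product of `E` with the generating function
of the complete homogeneous symmetric polynomials. -/
theorem sum_row_mul_coeff {ι : Type*} [Fintype ι] [DecidableEq ι] (x : ι → ℂ) {n : ℕ}
    (E : PowerSeries ℂ) (hE : ∀ r, n ≤ r → PowerSeries.coeff r E = 0) (f : ℕ) (i : Fin n) :
    ∑ j : Fin n, (if (i : ℕ) ≤ f + j then hs x (f + j - i) else 0) *
      PowerSeries.coeff (n - 1 - j) E =
    PowerSeries.coeff (f + (n - 1 - i)) (PowerSeries.mk (hs x) * E) := by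
  set m := f + (n - 1 - i) with hm
  have h1 : ∑ j : Fin n, (if (i : ℕ) ≤ f + j then hs x (f + j - i) else 0) *
      PowerSeries.coeff (n - 1 - j) E =
      ∑ r : Fin n, if (r : ℕ) ≤ m then hs x (m - r) * PowerSeries.coeff r E else 0 := by
    rw [← Equiv.sum_comp Fin.revPerm]
    refine Finset.sum_congr rfl fun r _ => ?_
    have hr := r.2
    have hi := i.2
    have e1 : n - 1 - (Fin.revPerm r : Fin n).1 = r := by
      simp only [Fin.revPerm_apply, Fin.val_rev]; omega
    have e2 : (i : ℕ) ≤ f + (Fin.revPerm r : Fin n).1 ↔ (r : ℕ) ≤ m := by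
      simp only [Fin.revPerm_apply, Fin.val_rev]; omega
    have e3 : f + (Fin.revPerm r : Fin n).1 - i = m - r := by
      simp only [Fin.revPerm_apply, Fin.val_rev]; omega
    simp only [e1, e2, e3]
    split_ifs <;> simp
  rw [h1, mul_comm (PowerSeries.mk (hs x)), PowerSeries.coeff_mul,
    Finset.Nat.sum_antidiagonal_eq_sum_range_succ
      (fun a b => PowerSeries.coeff a E * PowerSeries.coeff b (PowerSeries.mk (hs x))) m,
    Fin.sum_univ_eq_sum_range
      (fun r => if r ≤ m then hs x (m - r) * PowerSeries.coeff r E else 0) n, ← Finset.sum_filter]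
  have h2 : (Finset.range n).filter (· ≤ m) ⊆ Finset.range (m + 1) := by
    intro r hr
    simp only [Finset.mem_filter, Finset.mem_range] at hr ⊢
    omega
  refine Eq.trans (Finset.sum_congr rfl fun r _ => ?_)
    (Finset.sum_subset h2 fun r hr hr2 => ?_)
  · rw [PowerSeries.coeff_mk, mul_comm]
  · simp only [Finset.mem_filter, Finset.mem_range] at hr hr2
    rw [hE r (by omega), zero_mul]

/-- The bialternant formula: the Jacobi–Trudi determinant times the Vandermonde determinant is
an alternant. -/
theorem jacobiTrudi_mul_det (x : Fin N → ℂ) (f : Fin N → ℕ) :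
    jacobiTrudi x f * Matrix.det (Matrix.of fun i k : Fin N => x k ^ stair N i) =
      Matrix.det (Matrix.of fun i k : Fin N => x k ^ (f i + stair N i)) := by
  -- multiply by the matrix of coefficients of `E k = ∏_{l ≠ k} (1 - x_l t)`, whose product with the
  -- generating function of the `h_d` is the geometric series of `x_k`
  let E : Fin N → PowerSeries ℂ := fun k =>
    ∏ l ∈ Finset.univ.erase k, (1 - PowerSeries.C (x l) * PowerSeries.X)
  have hE : ∀ k, ∀ r, N ≤ r → PowerSeries.coeff r (E k) = 0 := by
    intro k r hr
    refine coeff_prod_one_sub x _ ?_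
    rw [Finset.card_erase_of_mem (Finset.mem_univ k), Finset.card_univ, Fintype.card_fin]
    have := k.2
    omega
  have hgeom : ∀ k, PowerSeries.mk (hs x) * E k = geom (x k) := by
    intro k
    have h1 := mk_hs_mul x
    rw [← Finset.mul_prod_erase _ _ (Finset.mem_univ k)] at h1
    calc PowerSeries.mk (hs x) * E k
        = PowerSeries.mk (hs x) * E k *
          (geom (x k) * (1 - PowerSeries.C (x k) * PowerSeries.X)) := by rw [geom_mul, mul_one]
      _ = geom (x k) * (PowerSeries.mk (hs x) *
          ((1 - PowerSeries.C (x k) * PowerSeries.X) * E k)) := by ring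
      _ = geom (x k) := by rw [h1, mul_one]
  let M : Matrix (Fin N) (Fin N) ℂ := Matrix.of fun j k => PowerSeries.coeff (N - 1 - j) (E k)
  have key : ∀ g : Fin N → ℕ, jacobiTrudi x g * M.det =
      Matrix.det (Matrix.of fun i k : Fin N => x k ^ (g i + stair N i)) := by
    intro g
    rw [jacobiTrudi, ← Matrix.det_mul]
    congr 1
    ext i k
    rw [Matrix.mul_apply]
    simp only [M, Matrix.of_apply]
    rw [sum_row_mul_coeff x (E k) (hE k) (g i) i, hgeom, geom, PowerSeries.coeff_mk]
    rfl
  -- the empty partition identifies the determinant of `M` with the Vandermonde determinant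
  have h0 : jacobiTrudi x (fun _ : Fin N => 0) = 1 := by
    rw [jacobiTrudi, Matrix.det_of_isUpperTriangular]
    · simp [hs_zero]
    · intro i j hij
      have : (j : ℕ) < i := hij
      simp only [Matrix.of_apply]
      rw [if_neg (by omega)]
  have h1 := key fun _ => 0
  rw [h0, one_mul] at h1
  simp only [zero_add] at h1
  rw [← h1, key]

/-- The alternant `∑ w, sgn w • x ^ (f ∘ w)`; for the staircase this is the Vandermonde
polynomial. -/
def alternant (f : Fin N → ℕ) : MvPolynomial (Fin N) ℂ :=
  ∑ w : Equiv.Perm (Fin N), Equiv.Perm.sign w • MvPolynomial.monomial (expo (f ∘ w)) (1 : ℂ)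

theorem eval_alternant (x : Fin N → ℂ) (f : Fin N → ℕ) :
    MvPolynomial.eval x (alternant f) =
      Matrix.det (Matrix.of fun i k : Fin N => x k ^ f i) := by
  rw [Matrix.det_apply, alternant, map_sum]
  refine Finset.sum_congr rfl fun w _ => ?_
  simp only [Units.smul_def, zsmul_eq_mul, map_mul, map_intCast, MvPolynomial.eval_monomial,
    one_mul, Matrix.of_apply]
  rw [Finsupp.prod_fintype _ _ fun i => pow_zero _]
  rfl

theorem altCoeff_eq_coeff_mul (κ : Fin N →₀ ℕ) (P : MvPolynomial (Fin N) ℂ) :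
    altCoeff κ P = (alternant (stair N) * P).coeff (κ + expo (stair N)) := by
  rw [alternant, Finset.sum_mul, MvPolynomial.coeff_sum]
  refine Finset.sum_congr rfl fun w _ => ?_
  rw [Units.smul_def, Units.smul_def, smul_mul_assoc, MvPolynomial.coeff_smul,
    MvPolynomial.coeff_monomial_mul', one_mul]

/-- The exponents of a Schur polynomial are at most its partition: its product with the Vandermonde
polynomial is an alternant, whose leading exponent is known. -/
theorem lexLE_altSum_hPoly (f : Fin N →₀ ℕ) (hf : Antitone f) :
    LexLE (altSum hPoly f) f := by
  by_cases h0 : altSum hPoly f = 0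
  · intro β hβ
    rw [h0] at hβ
    simp at hβ
  obtain ⟨κ, hκ, hmax⟩ := exists_max_exponent h0
  refine hmax.mono ?_
  have h1 : altCoeff κ (altSum hPoly f) ≠ 0 := by
    rw [altCoeff_of_max hmax]
    exact MvPolynomial.mem_support_iff.1 hκ
  have h2 : alternant (stair N) * altSum hPoly f = alternant (⇑f + stair N) := by
    refine MvPolynomial.funext fun x => ?_
    have h3 := jacobiTrudi_eq_eval x f
    have h4 : expo f = f := by ext; simp
    rw [h4] at h3
    rw [map_mul, eval_alternant, eval_alternant, ← h3, mul_comm, jacobiTrudi_mul_det]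
    rfl
  rw [altCoeff_eq_coeff_mul, h2, alternant, MvPolynomial.coeff_sum] at h1
  obtain ⟨w, -, hw⟩ := Finset.exists_ne_zero_of_sum_ne_zero h1
  rw [Units.smul_def, MvPolynomial.coeff_smul, MvPolynomial.coeff_monomial] at hw
  have h5 : expo ((⇑f + stair N) ∘ w) = κ + expo (stair N) := by
    by_contra hne
    rw [if_neg hne, smul_zero] at hw
    exact hw rfl
  have h6 : toLex (expo ((⇑f + stair N) ∘ w)) ≤ toLex (expo (⇑f + stair N)) :=
    toLex_expo_comp_le (hf.add stair_antitone) w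
  rw [h5] at h6
  have h7 : expo (⇑f + stair N) = f + expo (stair N) := by ext; simp
  rw [h7, toLex_add, toLex_add] at h6
  exact le_of_add_le_add_right h6

/-- If the generating function `∑ p_a(x) b ^ a` is symmetric in `x` and `b`, so is the matrix of
coefficients of the family `p`. -/
theorem coeff_comm_of_eval {p : (Fin N →₀ ℕ) → MvPolynomial (Fin N) ℂ}
    (hp : ∀ (d : ℕ) (x b : Fin N → ℂ),
      ∑ a ∈ Finset.univ.finsuppAntidiag d, MvPolynomial.eval x (p a) * ∏ j, b j ^ a j =
        ∑ a ∈ Finset.univ.finsuppAntidiag d, MvPolynomial.eval b (p a) * ∏ j, x j ^ a j)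
    (a b : Fin N →₀ ℕ) : (p a).coeff b = (p b).coeff a := by
  have mono : ∀ (c : Fin N →₀ ℕ) (r : ℂ) (x : Fin N → ℂ),
      MvPolynomial.eval x (MvPolynomial.monomial c r) = r * ∏ j, x j ^ c j := by
    intro c r x
    rw [MvPolynomial.eval_monomial, Finsupp.prod_fintype _ _ fun i => pow_zero _]
  have h1 : ∀ (d : ℕ) (x : Fin N → ℂ), ∀ a ∈ Finset.univ.finsuppAntidiag d,
      MvPolynomial.eval x (p a) =
        ∑ c ∈ Finset.univ.finsuppAntidiag d, (∏ j, x j ^ c j) * (p c).coeff a := by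
    intro d x a ha
    have h2 : ∑ c ∈ Finset.univ.finsuppAntidiag d,
        MvPolynomial.monomial c (MvPolynomial.eval x (p c)) =
        ∑ c ∈ Finset.univ.finsuppAntidiag d, MvPolynomial.C (∏ j, x j ^ c j) * p c := by
      refine MvPolynomial.funext fun b => ?_
      rw [map_sum, map_sum]
      simp only [mono, map_mul, MvPolynomial.eval_C]
      rw [hp d x b]
      exact Finset.sum_congr rfl fun c _ => mul_comm _ _
    have h3 := congrArg (MvPolynomial.coeff a) h2
    rw [MvPolynomial.coeff_sum, MvPolynomial.coeff_sum] at h3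
    simp only [MvPolynomial.coeff_monomial, MvPolynomial.coeff_C_mul] at h3
    rwa [Finset.sum_ite_eq' _ a, if_pos ha] at h3
  have h4 : ∀ (d : ℕ), ∀ a ∈ Finset.univ.finsuppAntidiag d, p a =
      ∑ c ∈ Finset.univ.finsuppAntidiag d, MvPolynomial.monomial c ((p c).coeff a) := by
    intro d a ha
    refine MvPolynomial.funext fun x => ?_
    rw [map_sum, h1 d x a ha]
    exact Finset.sum_congr rfl fun c _ => by rw [mono, mul_comm]
  have h5 : ∀ (d : ℕ) (a b : Fin N →₀ ℕ), a ∈ Finset.univ.finsuppAntidiag d →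
      (p a).coeff b = if b ∈ Finset.univ.finsuppAntidiag d then (p b).coeff a else 0 := by
    intro d a b ha
    rw [h4 d a ha, MvPolynomial.coeff_sum]
    simp only [MvPolynomial.coeff_monomial]
    rw [Finset.sum_ite_eq' _ b]
  have hself : ∀ a : Fin N →₀ ℕ, a ∈ Finset.univ.finsuppAntidiag (∑ j, a j) := by
    intro a
    rw [Finset.mem_finsuppAntidiag]
    exact ⟨rfl, Finset.subset_univ _⟩
  by_cases hab : b ∈ Finset.univ.finsuppAntidiag (∑ j, a j)
  · rw [h5 _ a b (hself a), if_pos hab]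
  · rw [h5 _ a b (hself a), if_neg hab, h5 _ b a (hself b), if_neg]
    rw [Finset.mem_finsuppAntidiag] at hab ⊢
    exact fun h => hab ⟨h.1.symm, Finset.subset_univ _⟩

theorem coeff_hPoly_comm (a b : Fin N →₀ ℕ) : (hPoly a).coeff b = (hPoly b).coeff a := by
  refine coeff_comm_of_eval (fun d x b => ?_) a b
  simp only [eval_hPoly]
  rw [← hs_mul_eq_sum, ← hs_mul_eq_sum, ← hs_comp_equiv (Equiv.prodComm _ _)]
  congr 1
  funext p
  exact mul_comm _ _

/-- In at least as many variables as there are parts, the Schur polynomial is the padded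
Jacobi–Trudi determinant. -/
theorem schur_eq_jacobiTrudi (lam : YoungDiagram) (hlam : lam.colLen 0 ≤ N)
    (A : Matrix (Fin N) (Fin N) ℂ) :
    schur lam A = jacobiTrudi (eigenvalueList A) (fun i => lam.rowLen i) := by
  have hzero : ∀ i : ℕ, ¬ i < lam.colLen 0 → lam.rowLen i = 0 := by
    intro i hi
    by_contra hne
    exact hi (YoungDiagram.mem_iff_lt_colLen.1
      (YoungDiagram.mem_iff_lt_rowLen.2 (Nat.pos_of_ne_zero hne)))
  -- the rows beyond the last part form a unitriangular block
  rw [jacobiTrudi, Matrix.twoBlockTriangular_det _ (fun i : Fin N => (i : ℕ) < lam.colLen 0)]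
  · have h2 : (Matrix.toSquareBlockProp (Matrix.of fun i j : Fin N =>
        if (i : ℕ) ≤ lam.rowLen i + j then hs (eigenvalueList A) (lam.rowLen i + j - i) else 0)
        (fun i : Fin N => ¬ (i : ℕ) < lam.colLen 0)).det = 1 := by
      rw [Matrix.det_of_isUpperTriangular]
      · refine Finset.prod_eq_one fun i _ => ?_
        simp [Matrix.toSquareBlockProp_def, hzero i.1 i.2, hs_zero]
      · intro i j hij
        have h3 : (j.1 : ℕ) < i.1 := hij
        simp only [Matrix.toSquareBlockProp_def, Matrix.of_apply]
        rw [hzero i.1 i.2, if_neg (by omega)]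
    let e : Fin (lam.colLen 0) ≃ {i : Fin N // (i : ℕ) < lam.colLen 0} :=
      { toFun := fun i => ⟨⟨i, i.2.trans_le hlam⟩, i.2⟩
        invFun := fun i => ⟨i.1, i.2⟩
        left_inv := fun i => rfl
        right_inv := fun i => rfl }
    rw [h2, mul_one, schur_eq_det, ← Matrix.det_submatrix_equiv_self e]
    rfl
  · intro i hi j hj
    simp only [Matrix.of_apply]
    rw [hzero i hi, if_neg (by omega)]

/-- The Schur polynomial vanishes if there are fewer variables than parts: the coefficients of
`∏ (1 - x_i t)` give a linear relation between the columns of the Jacobi–Trudi matrix. -/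
theorem schur_eq_zero (lam : YoungDiagram) (hlam : N < lam.colLen 0)
    (A : Matrix (Fin N) (Fin N) ℂ) : schur lam A = 0 := by
  let E : PowerSeries ℂ :=
    ∏ i, (1 - PowerSeries.C (eigenvalueList A i) * PowerSeries.X)
  have hE : ∀ r, lam.colLen 0 ≤ r → PowerSeries.coeff r E = 0 := fun r hr =>
    coeff_prod_one_sub _ _ (by rw [Finset.card_univ, Fintype.card_fin]; omega)
  have hE0 : PowerSeries.coeff 0 E = 1 := by
    rw [PowerSeries.coeff_zero_eq_constantCoeff]
    simp [E, map_prod]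
  rw [schur_eq_det]
  refine Matrix.exists_mulVec_eq_zero_iff.1
    ⟨fun j => PowerSeries.coeff (lam.colLen 0 - 1 - j) E, fun h => ?_, ?_⟩
  · have h1 := congrFun h ⟨lam.colLen 0 - 1, by omega⟩
    simp [hE0] at h1
  · funext i
    have hi : 0 < lam.rowLen i :=
      YoungDiagram.mem_iff_lt_rowLen.1 (YoungDiagram.mem_iff_lt_colLen.2 i.2)
    refine (sum_row_mul_coeff (eigenvalueList A) E hE (lam.rowLen i) i).trans ?_
    rw [mk_hs_mul, PowerSeries.coeff_one, if_neg (by omega)]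
    rfl

end JacobiTrudi

/-! ### Symmetric functions of `diag(a) H` as polynomials in `a` -/

section MinorPolynomial

variable {N : ℕ}

/-- The sum of the `k × k` principal minors of `diag(a) X`, as a polynomial in `a` whose coefficients
are polynomials in the entries of a generic matrix `X`. -/
def minorPoly (N k : ℕ) : MvPolynomial (Fin N) (MvPolynomial (Fin N × Fin N) ℂ) :=
  ∑ s ∈ Finset.univ.powersetCard k,
    MvPolynomial.monomial (∑ i ∈ s, Finsupp.single i 1)
      ((Matrix.mvPolynomialX (Fin N) (Fin N) ℂ).submatrix
        (Subtype.val : s → Fin N) (Subtype.val : s → Fin N)).det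

theorem eval_minorPoly {k : ℕ} (hk : k ≤ N) (a : Fin N → ℂ) (H : Matrix (Fin N) (Fin N) ℂ) :
    MvPolynomial.eval₂ (MvPolynomial.eval fun p : Fin N × Fin N => H p.1 p.2) a (minorPoly N k) =
      MvPolynomial.eval (eigenvalueList (Matrix.diagonal a * H))
        (MvPolynomial.esymm (Fin N) ℂ k) := by
  rw [eval_esymm_eigenvalueList _ hk, minorPoly, MvPolynomial.eval₂_sum]
  refine Finset.sum_congr rfl fun s _ => ?_
  have h1 : (Matrix.diagonal a * H).submatrix (Subtype.val : s → Fin N) (Subtype.val : s → Fin N) =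
      Matrix.diagonal (fun i : s => a i) *
        H.submatrix (Subtype.val : s → Fin N) (Subtype.val : s → Fin N) := by
    ext i j
    simp [Matrix.diagonal_mul]
  rw [h1, Matrix.det_mul, Matrix.det_diagonal, MvPolynomial.eval₂_monomial, RingHom.map_det,
    mul_comm]
  congr 1
  · rw [Finsupp.prod_fintype _ _ fun i => pow_zero _, Finset.prod_coe_sort s a,
      ← Finset.prod_subset (Finset.subset_univ s)]
    · refine Finset.prod_congr rfl fun i hi => ?_
      simp [Finsupp.finsetSum_apply, Finsupp.single_apply, hi]
    · intro i _ hi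
      simp [Finsupp.finsetSum_apply, Finsupp.single_apply, hi]
  · congr 1
    ext i j
    simp [Matrix.mvPolynomialX]

/-- The exponents in `a` of the principal minors of `diag(a) X` are those of the elementary symmetric
polynomial. -/
theorem lexLE_minorPoly (k : Fin N) :
    LexLE (minorPoly N (k + 1)) (expo (Fin.accumulate N N (Finsupp.single k 1))) := by
  refine LexLE.sum fun s hs β hβ => ?_
  have h1 : β = ∑ i ∈ s, Finsupp.single i 1 :=
    Finset.mem_singleton.1 (MvPolynomial.support_monomial_subset hβ)
  have h2 : β ∈ (MvPolynomial.esymm (Fin N) ℂ (k + 1)).support := by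
    rw [MvPolynomial.support_esymm, Finset.mem_image]
    exact ⟨s, hs, h1.symm⟩
  have h3 := MvPolynomial.supDegree_esymm (R := ℂ) (n := N) k.2
  have h4 : AddMonoidAlgebra.supDegree toLex (MvPolynomial.esymm (Fin N) ℂ (k + 1)) =
      toLex (expo (Fin.accumulate N N (Finsupp.single k 1))) := by
    rw [← ofLex_inj, DFunLike.ext'_iff, h3]
    rfl
  rw [← h4]
  exact Finset.le_sup (f := toLex) h2

/-- For a symmetric polynomial `f` with exponents bounded by `ν`, the function
`f(eigenvalues of diag(a) H)` is a polynomial in `a` with exponents bounded by `ν`, whose coefficients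
are polynomials in the entries of `H`. -/
theorem exists_lexLE_eval_diagonal_mul {f : MvPolynomial (Fin N) ℂ} (hf : f.IsSymmetric)
    {ν : Fin N →₀ ℕ} (hν : LexLE f ν) :
    ∃ F : MvPolynomial (Fin N) (MvPolynomial (Fin N × Fin N) ℂ), LexLE F ν ∧
      ∀ (a : Fin N → ℂ) (H : Matrix (Fin N) (Fin N) ℂ),
        MvPolynomial.eval (eigenvalueList (Matrix.diagonal a * H)) f =
          MvPolynomial.eval₂ (MvPolynomial.eval fun p : Fin N × Fin N => H p.1 p.2) a F := by
  obtain ⟨Q, rfl, hQ⟩ := exists_esymm_of_lexLE hf hν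
  refine ⟨∑ t ∈ Q.support, MvPolynomial.C (MvPolynomial.C (Q.coeff t)) *
    ∏ k : Fin N, minorPoly N (k + 1) ^ t k, LexLE.sum fun t ht => ?_, fun a H => ?_⟩
  · have h1 := (LexLE.C (N := N) (MvPolynomial.C (σ := Fin N × Fin N) (Q.coeff t))).mul
      (LexLE.prod (s := Finset.univ) fun (k : Fin N) _ => (lexLE_minorPoly k).pow (t k))
    refine h1.mono (le_of_eq_of_le ?_ (hQ t ht))
    congr 1
    ext j
    simp [Finsupp.finsetSum_apply, Fin.accumulate, Finsupp.single_apply, Finset.sum_ite]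
  · have h1 : ∀ k : Fin N, MvPolynomial.eval (eigenvalueList (Matrix.diagonal a * H))
        (MvPolynomial.esymm (Fin N) ℂ (k + 1)) = MvPolynomial.eval₂
          (MvPolynomial.eval fun p : Fin N × Fin N => H p.1 p.2) a (minorPoly N (k + 1)) :=
      fun k => (eval_minorPoly (by omega) a H).symm
    conv_lhs => rw [Q.as_sum, map_sum, map_sum]
    rw [MvPolynomial.eval₂_sum]
    refine Finset.sum_congr rfl fun t _ => ?_
    rw [MvPolynomial.aeval_monomial, Finsupp.prod_fintype _ _ fun i => pow_zero _,
      MvPolynomial.eval₂_mul, MvPolynomial.eval₂_C, MvPolynomial.eval_C, map_mul,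
      MvPolynomial.algebraMap_eq, MvPolynomial.eval_C, map_prod, MvPolynomial.eval₂_prod]
    congr 1
    refine Finset.prod_congr rfl fun k _ => ?_
    rw [map_pow, h1, MvPolynomial.eval₂_pow]

/-- Averaging `f(eigenvalues of diag(a) H)` over a random matrix `H` gives a polynomial in `a` with
the same bound on its exponents. -/
theorem exists_lexLE_integral {Ω : Type*} [MeasurableSpace Ω] {μ : Measure Ω}
    {M : Ω → Matrix (Fin N) (Fin N) ℂ}
    (hM : ∀ q : MvPolynomial (Fin N × Fin N) ℂ,
      Integrable (fun ω => MvPolynomial.eval (fun p => M ω p.1 p.2) q) μ)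
    {f : MvPolynomial (Fin N) ℂ} (hf : f.IsSymmetric) {ν : Fin N →₀ ℕ} (hν : LexLE f ν) :
    ∃ P : MvPolynomial (Fin N) ℂ, LexLE P ν ∧ ∀ a : Fin N → ℂ, MvPolynomial.eval a P =
      ∫ ω, MvPolynomial.eval (eigenvalueList (Matrix.diagonal a * M ω)) f ∂μ := by
  obtain ⟨F, hF, hFe⟩ := exists_lexLE_eval_diagonal_mul hf hν
  refine ⟨∑ β ∈ F.support, MvPolynomial.monomial β
    (∫ ω, MvPolynomial.eval (fun p => M ω p.1 p.2) (F.coeff β) ∂μ),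
    LexLE.sum fun β hβ γ hγ => ?_, fun a => ?_⟩
  · rw [Finset.mem_singleton.1 (MvPolynomial.support_monomial_subset hγ)]
    exact hF β hβ
  · simp only [hFe]
    have h1 : ∀ ω, MvPolynomial.eval₂
        (MvPolynomial.eval fun p : Fin N × Fin N => M ω p.1 p.2) a F =
        ∑ β ∈ F.support, MvPolynomial.eval (fun p => M ω p.1 p.2) (F.coeff β) *
          β.prod fun i e => a i ^ e := fun ω => MvPolynomial.eval₂_eq _ _ _
    simp only [h1]
    rw [integral_finsetSum _ fun β _ => (hM _).mul_const _, map_sum]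
    refine Finset.sum_congr rfl fun β _ => ?_
    rw [integral_mul_const, MvPolynomial.eval_monomial]

end MinorPolynomial

/-! ### Gaussian measures and integration by parts -/

section Gaussian

variable {E : Type*} [NormedAddCommGroup E]

/-- Continuous functions of at most polynomial growth. -/
def PolyGrowth (f : E → ℂ) : Prop :=
  Continuous f ∧ ∃ (C : ℝ) (k : ℕ), ∀ x, ‖f x‖ ≤ C * (1 + ‖x‖) ^ k

theorem PolyGrowth.const (c : ℂ) : PolyGrowth fun _ : E => c :=
  ⟨continuous_const, ‖c‖, 0, fun x => by simp⟩

theorem PolyGrowth.exists_nonneg {f : E → ℂ} (hf : PolyGrowth f) :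
    ∃ (C : ℝ) (k : ℕ), 0 ≤ C ∧ ∀ x, ‖f x‖ ≤ C * (1 + ‖x‖) ^ k := by
  obtain ⟨-, C, k, h⟩ := hf
  refine ⟨C, k, ?_, h⟩
  have := (norm_nonneg _).trans (h 0)
  simpa using this

theorem PolyGrowth.add {f g : E → ℂ} (hf : PolyGrowth f) (hg : PolyGrowth g) :
    PolyGrowth fun x => f x + g x := by
  obtain ⟨C, k, hC, h⟩ := hf.exists_nonneg
  obtain ⟨D, l, hD, h'⟩ := hg.exists_nonneg
  refine ⟨hf.1.add hg.1, C + D, k + l, fun x => ?_⟩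
  have h1 : (1 : ℝ) ≤ 1 + ‖x‖ := by linarith [norm_nonneg x]
  have hk : (1 + ‖x‖) ^ k ≤ (1 + ‖x‖) ^ (k + l) := pow_le_pow_right₀ h1 (by omega)
  have hl : (1 + ‖x‖) ^ l ≤ (1 + ‖x‖) ^ (k + l) := pow_le_pow_right₀ h1 (by omega)
  calc ‖f x + g x‖ ≤ ‖f x‖ + ‖g x‖ := norm_add_le _ _
    _ ≤ C * (1 + ‖x‖) ^ (k + l) + D * (1 + ‖x‖) ^ (k + l) :=
      add_le_add ((h x).trans (mul_le_mul_of_nonneg_left hk hC))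
        ((h' x).trans (mul_le_mul_of_nonneg_left hl hD))
    _ = _ := by ring

theorem PolyGrowth.mul {f g : E → ℂ} (hf : PolyGrowth f) (hg : PolyGrowth g) :
    PolyGrowth fun x => f x * g x := by
  obtain ⟨C, k, hC, h⟩ := hf.exists_nonneg
  obtain ⟨D, l, hD, h'⟩ := hg.exists_nonneg
  refine ⟨hf.1.mul hg.1, C * D, k + l, fun x => ?_⟩
  rw [norm_mul, pow_add]
  calc ‖f x‖ * ‖g x‖ ≤ (C * (1 + ‖x‖) ^ k) * (D * (1 + ‖x‖) ^ l) :=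
        mul_le_mul (h x) (h' x) (norm_nonneg _) (by positivity)
    _ = _ := by ring

theorem PolyGrowth.const_mul {f : E → ℂ} (c : ℂ) (hf : PolyGrowth f) :
    PolyGrowth fun x => c * f x := (PolyGrowth.const c).mul hf

theorem PolyGrowth.sum {ι : Type*} {s : Finset ι} {f : ι → E → ℂ}
    (hf : ∀ i ∈ s, PolyGrowth (f i)) : PolyGrowth fun x => ∑ i ∈ s, f i x := by
  classical
  induction s using Finset.induction_on with
  | empty => simpa using PolyGrowth.const (E := E) 0
  | insert i s hi ih =>
    simp only [Finset.sum_insert hi]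
    exact (hf i (by simp)).add (ih fun j hj => hf j (by simp [hj]))

theorem PolyGrowth.pow {f : E → ℂ} (hf : PolyGrowth f) (n : ℕ) :
    PolyGrowth fun x => f x ^ n := by
  induction n with
  | zero => simpa using PolyGrowth.const (E := E) 1
  | succ n ih => simpa only [pow_succ] using ih.mul hf

theorem PolyGrowth.eval {σ : Type*} {f : σ → E → ℂ} (hf : ∀ i, PolyGrowth (f i))
    (q : MvPolynomial σ ℂ) : PolyGrowth fun x => MvPolynomial.eval (fun i => f i x) q := by
  induction q using MvPolynomial.induction_on with
  | C c => simpa using PolyGrowth.const (E := E) c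
  | add p q hp hq => simpa using hp.add hq
  | mul_X p i hp => simpa using hp.mul (hf i)

variable [NormedSpace ℝ E] [FiniteDimensional ℝ E]

theorem PolyGrowth.linear (l : E →ₗ[ℝ] ℂ) : PolyGrowth fun x => l x := by
  let L := LinearMap.toContinuousLinearMap l
  refine ⟨L.continuous, ‖L‖, 1, fun x => ?_⟩
  calc ‖L x‖ ≤ ‖L‖ * ‖x‖ := L.le_opNorm x
    _ ≤ ‖L‖ * (1 + ‖x‖) ^ 1 := mul_le_mul_of_nonneg_left (by simp) (norm_nonneg _)

theorem continuous_bilin_self {B : LinearMap.BilinForm ℝ E} : Continuous fun x => B x x := by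
  have h : Continuous fun p : E × E =>
      (LinearMap.toContinuousLinearMap
        (LinearMap.toContinuousLinearMap.toLinearMap ∘ₗ B) p.1 : E →L[ℝ] ℝ) p.2 := by
    fun_prop
  exact h.comp (continuous_id.prodMk continuous_id)

variable [MeasurableSpace E] [BorelSpace E] (m : Measure E) [m.IsAddHaarMeasure]
  (B : LinearMap.BilinForm ℝ E)

/-- The Gaussian probability measure with density proportional to `exp (-B x x)`. -/
def gaussian : Measure E := m.tilted fun x => -B x x

/-- A Gaussian dominates any power, from `(1 + s) ^ n ≤ n! * exp (1 + s)` and completing the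
square. -/
theorem one_add_pow_mul_exp_le {c : ℝ} (hc : 0 < c) (n : ℕ) {s : ℝ} (hs : 0 ≤ s) :
    (1 + s) ^ n * Real.exp (-(c * s ^ 2)) ≤ n.factorial * Real.exp (1 + 1 / (4 * c)) := by
  have h1 : (1 + s) ^ n ≤ n.factorial * Real.exp (1 + s) := by
    have := Real.pow_div_factorial_le_exp (1 + s) (by linarith) n
    rwa [div_le_iff₀' (by positivity)] at this
  have h2 : 1 + s + -(c * s ^ 2) ≤ 1 + 1 / (4 * c) := by
    have h3 : 1 / (4 * c) - s + c * s ^ 2 = (2 * c * s - 1) ^ 2 / (4 * c) := by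
      field_simp
      ring
    have h4 : 0 ≤ (2 * c * s - 1) ^ 2 / (4 * c) := by positivity
    linarith
  calc (1 + s) ^ n * Real.exp (-(c * s ^ 2))
      ≤ n.factorial * Real.exp (1 + s) * Real.exp (-(c * s ^ 2)) :=
        mul_le_mul_of_nonneg_right h1 (Real.exp_pos _).le
    _ = n.factorial * Real.exp (1 + s + -(c * s ^ 2)) := by rw [mul_assoc, ← Real.exp_add]
    _ ≤ _ := mul_le_mul_of_nonneg_left (Real.exp_le_exp.2 h2) (by positivity)

variable {m B}

theorem integrable_mul_exp {c : ℝ} (hc : 0 < c) (hB : ∀ x, c * ‖x‖ ^ 2 ≤ B x x) {f : E → ℂ}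
    (hf : PolyGrowth f) : Integrable (fun x => f x * (Real.exp (-B x x) : ℂ)) m := by
  obtain ⟨C, k, hC, h⟩ := hf.exists_nonneg
  let r := Module.finrank ℝ E + 1
  have hr := integrable_one_add_norm (E := E) (μ := m) (r := (r : ℝ))
    (by simp only [r]; push_cast; linarith)
  refine (hr.const_mul (C * ((k + r).factorial * Real.exp (1 + 1 / (4 * c))))).mono'
    (hf.1.mul (Complex.continuous_ofReal.comp
      (Real.continuous_exp.comp continuous_bilin_self.neg))).aestronglyMeasurable
    (Filter.Eventually.of_forall fun x => ?_)
  have hpos : 0 < 1 + ‖x‖ := by positivity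
  have h1 := one_add_pow_mul_exp_le hc (k + r) (norm_nonneg x)
  rw [norm_mul, Complex.norm_real, Real.norm_of_nonneg (Real.exp_pos _).le,
    Real.rpow_neg hpos.le, Real.rpow_natCast, ← div_eq_mul_inv, le_div_iff₀ (by positivity)]
  calc ‖f x‖ * Real.exp (-B x x) * (1 + ‖x‖) ^ r
      ≤ (C * (1 + ‖x‖) ^ k) * Real.exp (-(c * ‖x‖ ^ 2)) * (1 + ‖x‖) ^ r := by
        gcongr
        · exact h x
        · exact hB x
    _ = C * ((1 + ‖x‖) ^ (k + r) * Real.exp (-(c * ‖x‖ ^ 2))) := by ring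
    _ ≤ _ := mul_le_mul_of_nonneg_left h1 hC

theorem integrable_exp_bilin {c : ℝ} (hc : 0 < c) (hB : ∀ x, c * ‖x‖ ^ 2 ≤ B x x) :
    Integrable (fun x => Real.exp (-B x x)) m := by
  have h := (integrable_mul_exp (m := m) hc hB (PolyGrowth.const 1)).re
  refine h.congr (Filter.Eventually.of_forall fun x => ?_)
  simp only [one_mul]
  exact Complex.ofReal_re _

theorem PolyGrowth.integrable {c : ℝ} (hc : 0 < c) (hB : ∀ x, c * ‖x‖ ^ 2 ≤ B x x)
    {f : E → ℂ} (hf : PolyGrowth f) : Integrable f (gaussian m B) := by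
  refine (integrable_tilted_iff (integrable_exp_bilin hc hB) f).2 ?_
  refine (integrable_mul_exp (m := m) hc hB hf).congr (Filter.Eventually.of_forall fun x => ?_)
  simp [mul_comm]

theorem isProbabilityMeasure_gaussian {c : ℝ} (hc : 0 < c) (hB : ∀ x, c * ‖x‖ ^ 2 ≤ B x x) :
    IsProbabilityMeasure (gaussian m B) :=
  isProbabilityMeasure_tilted (integrable_exp_bilin hc hB)

/-- Gaussian integration by parts: multiplication by `2 B x v` is adjoint to the derivative along
`v`. -/
theorem integral_bilin_mul {c : ℝ} (hc : 0 < c) (hB : ∀ x, c * ‖x‖ ^ 2 ≤ B x x)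
    (hsymm : ∀ x y, B x y = B y x) (v : E) {f f' : E → ℂ} (hf : PolyGrowth f)
    (hf' : PolyGrowth f') (hd : ∀ x, HasLineDerivAt ℝ f (f' x) x v) :
    ∫ x, ((2 * B x v : ℝ) : ℂ) * f x ∂(gaussian m B) = ∫ x, f' x ∂(gaussian m B) := by
  have hlin : PolyGrowth fun x => ((2 * B x v : ℝ) : ℂ) := by
    have h1 := PolyGrowth.linear (Complex.ofRealCLM.toLinearMap ∘ₗ ((2 : ℝ) • B.flip v))
    refine (congrArg PolyGrowth (funext fun x => ?_)).mp h1
    simp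
  have hg : ∀ x, HasLineDerivAt ℝ (fun x => (Real.exp (-B x x) : ℂ))
      (-((2 * B x v : ℝ) : ℂ) * (Real.exp (-B x x) : ℂ)) x v := by
    intro x
    have h1 : ∀ t : ℝ, -B (x + t • v) (x + t • v) = -(B x x + t * (2 * B x v) + t ^ 2 * B v v) := by
      intro t
      simp only [map_add, LinearMap.add_apply, map_smul, LinearMap.smul_apply, smul_eq_mul,
        hsymm v x]
      ring
    have h2 : HasDerivAt (fun t : ℝ => -(B x x + t * (2 * B x v) + t ^ 2 * B v v))
        (-(2 * B x v)) 0 := by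
      have h3 := ((((hasDerivAt_id (0 : ℝ)).mul_const (2 * B x v)).const_add (B x x)).add
        ((hasDerivAt_pow 2 (0 : ℝ)).mul_const (B v v))).neg
      refine h3.congr_deriv ?_
      simp
    have h4 := (h2.exp).ofReal_comp
    unfold HasLineDerivAt
    simp only [h1]
    convert! h4 using 1
    simp [mul_comm]
  have h := integral_bilinear_hasLineDerivAt_right_eq_neg_left_of_integrable (μ := m)
    (B := ContinuousLinearMap.mul ℝ ℂ) (f := f) (f' := f') (v := v)
    (g := fun x => (Real.exp (-B x x) : ℂ))
    (g' := fun x => -((2 * B x v : ℝ) : ℂ) * (Real.exp (-B x x) : ℂ))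
    (by simpa using integrable_mul_exp (m := m) hc hB hf')
    (by
      have h1 := (integrable_mul_exp (m := m) hc hB (hf.mul hlin)).neg
      refine h1.congr (Filter.Eventually.of_forall fun x => ?_)
      simp only [ContinuousLinearMap.mul_apply', Pi.neg_apply]
      ring)
    (by simpa using integrable_mul_exp (m := m) hc hB hf)
    (fun x _ => hd x) (fun x _ => hg x)
  simp only [ContinuousLinearMap.mul_apply'] at h
  have h' : ∫ x, (((2 * B x v : ℝ) : ℂ) * f x) * (Real.exp (-B x x) : ℂ) ∂m =
      ∫ x, f' x * (Real.exp (-B x x) : ℂ) ∂m := by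
    rw [← neg_eq_iff_eq_neg, ← integral_neg] at h
    rw [← h]
    exact integral_congr_ae (Filter.Eventually.of_forall fun x => by ring)
  -- both sides carry the same normalising constant
  have htilt : ∀ F : E → ℂ, ∫ x, F x ∂(gaussian m B) =
      (((∫ x, Real.exp (-B x x) ∂m : ℝ))⁻¹ : ℝ) * ∫ x, F x * (Real.exp (-B x x) : ℂ) ∂m := by
    intro F
    rw [gaussian, integral_tilted, ← integral_const_mul]
    refine integral_congr_ae (Filter.Eventually.of_forall fun x => ?_)
    simp only [Complex.real_smul]
    push_cast
    ring
  rw [htilt, htilt, h']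

end Gaussian

/-! ### Complex Gaussian vectors -/

section ComplexGaussian

variable {ι : Type*} [Fintype ι]

/-- The real inner product `∑ i, Re (conj (z i) * v i)` on `ℂ ^ ι`. -/
def cplxForm (ι : Type*) [Fintype ι] : LinearMap.BilinForm ℝ (ι → ℂ) :=
  LinearMap.mk₂ ℝ (fun z v => ∑ i, ((z i).re * (v i).re + (z i).im * (v i).im))
    (fun z z' v => by
      rw [← Finset.sum_add_distrib]
      exact Finset.sum_congr rfl fun i _ => by simp; ring)
    (fun r z v => by
      rw [smul_eq_mul, Finset.mul_sum]
      exact Finset.sum_congr rfl fun i _ => by simp; ring)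
    (fun z v v' => by
      rw [← Finset.sum_add_distrib]
      exact Finset.sum_congr rfl fun i _ => by simp; ring)
    (fun r z v => by
      rw [smul_eq_mul, Finset.mul_sum]
      exact Finset.sum_congr rfl fun i _ => by simp; ring)

theorem cplxForm_apply (z v : ι → ℂ) :
    cplxForm ι z v = ∑ i, ((z i).re * (v i).re + (z i).im * (v i).im) := rfl

theorem cplxForm_symm (z v : ι → ℂ) : cplxForm ι z v = cplxForm ι v z := by
  simp only [cplxForm_apply]
  exact Finset.sum_congr rfl fun i _ => by ring

/-- The coercivity bound required of a Gaussian measure, with constant `1`. The norm on `ι → ℂ` is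
the supremum norm. -/
theorem norm_sq_le_cplxForm (z : ι → ℂ) : 1 * ‖z‖ ^ 2 ≤ cplxForm ι z z := by
  have h0 : cplxForm ι z z = ∑ i, ‖z i‖ ^ 2 := by
    rw [cplxForm_apply]
    refine Finset.sum_congr rfl fun i _ => ?_
    rw [← Complex.normSq_eq_norm_sq, Complex.normSq_apply]
  rw [one_mul, h0]
  have h1 : ‖z‖ ≤ Real.sqrt (∑ i, ‖z i‖ ^ 2) := by
    refine (pi_norm_le_iff_of_nonneg (Real.sqrt_nonneg _)).2 fun i => ?_
    refine Real.le_sqrt_of_sq_le ?_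
    exact Finset.single_le_sum (f := fun i => ‖z i‖ ^ 2) (fun j _ => by positivity)
      (Finset.mem_univ i)
  calc ‖z‖ ^ 2 ≤ Real.sqrt (∑ i, ‖z i‖ ^ 2) ^ 2 := pow_le_pow_left₀ (norm_nonneg _) h1 2
    _ = _ := Real.sq_sqrt (Finset.sum_nonneg fun i _ => by positivity)

/-- The standard complex Gaussian measure on `ℂ ^ ι`, with density proportional to
`exp (-∑ i, |z i| ^ 2)`. -/
def cGauss (ι : Type*) [Fintype ι] : Measure (ι → ℂ) := gaussian volume (cplxForm ι)

instance (ι : Type*) [Fintype ι] : IsProbabilityMeasure (cGauss ι) := by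
  classical
  exact isProbabilityMeasure_gaussian one_pos norm_sq_le_cplxForm

theorem PolyGrowth.integrable_cGauss {f : (ι → ℂ) → ℂ} (hf : PolyGrowth f) :
    Integrable f (cGauss ι) :=
  hf.integrable one_pos norm_sq_le_cplxForm

/-- The sesquilinear form `∑ conj (z i) * M i j * w j`. -/
def sesq (M : Matrix ι ι ℂ) (z w : ι → ℂ) : ℂ := star z ⬝ᵥ (M *ᵥ w)

theorem polyGrowth_apply (i : ι) : PolyGrowth fun z : ι → ℂ => z i :=
  PolyGrowth.linear ((LinearMap.proj i : (ι → ℂ) →ₗ[ℂ] ℂ).restrictScalars ℝ)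

theorem polyGrowth_star_apply (i : ι) : PolyGrowth fun z : ι → ℂ => star (z i) :=
  PolyGrowth.linear (Complex.conjAe.toLinearMap ∘ₗ
    ((LinearMap.proj i : (ι → ℂ) →ₗ[ℂ] ℂ).restrictScalars ℝ))

theorem polyGrowth_mulVec (M : Matrix ι ι ℂ) (i : ι) :
    PolyGrowth fun z : ι → ℂ => (M *ᵥ z) i :=
  PolyGrowth.sum fun j _ => (polyGrowth_apply j).const_mul (M i j)

theorem polyGrowth_vecMul (M : Matrix ι ι ℂ) (i : ι) :
    PolyGrowth fun z : ι → ℂ => (star z ᵥ* M) i :=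
  PolyGrowth.sum fun j _ => (polyGrowth_star_apply j).mul (PolyGrowth.const (M j i))

theorem polyGrowth_sesq (M : Matrix ι ι ℂ) : PolyGrowth fun z : ι → ℂ => sesq M z z :=
  PolyGrowth.sum fun j _ => (polyGrowth_star_apply j).mul (polyGrowth_mulVec M j)

theorem hasLineDerivAt_sesq (M : Matrix ι ι ℂ) (z v : ι → ℂ) :
    HasLineDerivAt ℝ (fun z => sesq M z z) (sesq M v z + sesq M z v) z v := by
  have h1 : ∀ t : ℝ, sesq M (z + t • v) (z + t • v) =
      sesq M z z + (t : ℂ) * (sesq M v z + sesq M z v) + (t : ℂ) ^ 2 * sesq M v v := by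
    intro t
    have h2 : z + t • v = z + (t : ℂ) • v := rfl
    have h3 : star ((t : ℂ) • v) = (t : ℂ) • star v := by simp
    rw [h2]
    simp only [sesq, star_add, h3, mulVec_add, mulVec_smul, add_dotProduct, dotProduct_add,
      smul_dotProduct, dotProduct_smul, smul_eq_mul]
    ring
  unfold HasLineDerivAt
  simp only [h1]
  have h4 : HasDerivAt (fun t : ℝ => (t : ℂ)) 1 0 := Complex.ofRealCLM.hasDerivAt
  refine (((h4.mul_const (sesq M v z + sesq M z v)).const_add (sesq M z z)).add
    ((h4.pow 2).mul_const (sesq M v v))).congr_deriv ?_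
  simp

theorem hasLineDerivAt_vecMul (P : Matrix ι ι ℂ) (i : ι) (z v : ι → ℂ) :
    HasLineDerivAt ℝ (fun z => (star z ᵥ* P) i) ((star v ᵥ* P) i) z v := by
  have h1 : ∀ t : ℝ, (star (z + t • v) ᵥ* P) i =
      (star z ᵥ* P) i + (t : ℂ) * (star v ᵥ* P) i := by
    intro t
    have h2 : z + t • v = z + (t : ℂ) • v := rfl
    have h3 : star ((t : ℂ) • v) = (t : ℂ) • star v := by simp
    rw [h2]
    simp only [star_add, h3, add_vecMul, smul_vecMul, Pi.add_apply, Pi.smul_apply, smul_eq_mul]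
  unfold HasLineDerivAt
  simp only [h1]
  have h4 : HasDerivAt (fun t : ℝ => (t : ℂ)) 1 0 := Complex.ofRealCLM.hasDerivAt
  refine ((h4.mul_const ((star v ᵥ* P) i)).const_add ((star z ᵥ* P) i)).congr_deriv ?_
  simp

theorem hasLineDerivAt_vecMul_mul_sesq_pow (P M : Matrix ι ι ℂ) (i : ι) (d : ℕ) (z v : ι → ℂ) :
    HasLineDerivAt ℝ (fun z => (star z ᵥ* P) i * sesq M z z ^ d)
      ((star v ᵥ* P) i * sesq M z z ^ d + (star z ᵥ* P) i *
        (d * sesq M z z ^ (d - 1) * (sesq M v z + sesq M z v))) z v := by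
  have h1 := hasLineDerivAt_vecMul P i z v
  have h2 := hasLineDerivAt_sesq M z v
  unfold HasLineDerivAt at h1 h2 ⊢
  refine (h1.mul (h2.pow d)).congr_deriv ?_
  simp

theorem polyGrowth_cplxForm (v : ι → ℂ) :
    PolyGrowth fun z : ι → ℂ => ((2 * cplxForm ι z v : ℝ) : ℂ) := by
  have h1 := PolyGrowth.linear (Complex.ofRealCLM.toLinearMap ∘ₗ ((2 : ℝ) • (cplxForm ι).flip v))
  refine (congrArg PolyGrowth (funext fun z => ?_)).mp h1
  simp

variable [DecidableEq ι]

/-- Integration by parts for the complex Gaussian measure: multiplication by `z i` is adjoint to the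
derivative `∂/∂z̄ᵢ`, a combination of the derivatives along the real and the imaginary axis. -/
theorem integral_apply_mul (i : ι) {f f₁ f₂ : (ι → ℂ) → ℂ} (hf : PolyGrowth f)
    (hf₁ : PolyGrowth f₁) (hf₂ : PolyGrowth f₂)
    (h₁ : ∀ z, HasLineDerivAt ℝ f (f₁ z) z (Pi.single i 1))
    (h₂ : ∀ z, HasLineDerivAt ℝ f (f₂ z) z (Pi.single i Complex.I)) :
    ∫ z, z i * f z ∂(cGauss ι) = ∫ z, (1 / 2 * f₁ z + 1 / 2 * Complex.I * f₂ z) ∂(cGauss ι) := by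
  have e₁ := integral_bilin_mul (m := volume) one_pos norm_sq_le_cplxForm cplxForm_symm
    (Pi.single i 1) hf hf₁ h₁
  have e₂ := integral_bilin_mul (m := volume) one_pos norm_sq_le_cplxForm cplxForm_symm
    (Pi.single i Complex.I) hf hf₂ h₂
  change ∫ z, _ ∂(cGauss ι) = ∫ z, _ ∂(cGauss ι) at e₁ e₂
  have hz : ∀ z : ι → ℂ, z i * f z =
      1 / 2 * (((2 * cplxForm ι z (Pi.single i 1) : ℝ) : ℂ) * f z) +
        1 / 2 * Complex.I * (((2 * cplxForm ι z (Pi.single i Complex.I) : ℝ) : ℂ) * f z) := by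
    intro z
    have h1 : cplxForm ι z (Pi.single i 1) = (z i).re := by
      rw [cplxForm_apply, Finset.sum_eq_single i]
      · simp
      · intro j _ hj
        simp [Pi.single_eq_of_ne hj]
      · simp
    have h2 : cplxForm ι z (Pi.single i Complex.I) = (z i).im := by
      rw [cplxForm_apply, Finset.sum_eq_single i]
      · simp
      · intro j _ hj
        simp [Pi.single_eq_of_ne hj]
      · simp
    rw [h1, h2]
    conv_lhs => rw [← Complex.re_add_im (z i)]
    push_cast
    ring
  have i₁ := ((polyGrowth_cplxForm (Pi.single i 1)).mul hf).integrable_cGauss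
  have i₂ := ((polyGrowth_cplxForm (Pi.single i Complex.I)).mul hf).integrable_cGauss
  simp only [hz]
  rw [integral_add (i₁.const_mul _) (i₂.const_mul _), integral_const_mul, integral_const_mul, e₁,
    e₂, integral_add (hf₁.integrable_cGauss.const_mul _) (hf₂.integrable_cGauss.const_mul _),
    integral_const_mul, integral_const_mul]

theorem integral_apply_mul_vecMul (P M : Matrix ι ι ℂ) (d : ℕ) (i : ι) :
    ∫ z, z i * ((star z ᵥ* P) i * sesq M z z ^ d) ∂(cGauss ι) =
      ∫ z, (P i i * sesq M z z ^ d +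
        d * ((star z ᵥ* P) i * (M *ᵥ z) i * sesq M z z ^ (d - 1))) ∂(cGauss ι) := by
  have hstar : ∀ c : ℂ, star (Pi.single i c : ι → ℂ) = Pi.single i (star c) :=
    fun c => funext fun j => by
      rcases eq_or_ne j i with rfl | h
      · simp
      · simp [Pi.single_eq_of_ne h]
  have hS1 : ∀ (c : ℂ) (z : ι → ℂ), sesq M (Pi.single i c) z = star c * (M *ᵥ z) i :=
    fun c z => by rw [sesq, hstar, single_dotProduct]
  have hS2 : ∀ (c : ℂ) (z : ι → ℂ), sesq M z (Pi.single i c) = (star z ᵥ* M) i * c :=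
    fun c z => by rw [sesq, dotProduct_mulVec, dotProduct_single]
  have hS3 : ∀ c : ℂ, (star (Pi.single i c : ι → ℂ) ᵥ* P) i = star c * P i i :=
    fun c => by rw [hstar, single_vecMul]; simp
  have hq := fun n => (polyGrowth_sesq M).pow n
  have hder : ∀ (c : ℂ) (z : ι → ℂ), HasLineDerivAt ℝ
      (fun z => (star z ᵥ* P) i * sesq M z z ^ d)
      (star c * P i i * sesq M z z ^ d + (star z ᵥ* P) i *
        (d * sesq M z z ^ (d - 1) * (star c * (M *ᵥ z) i + (star z ᵥ* M) i * c))) z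
      (Pi.single i c) := by
    intro c z
    have h := hasLineDerivAt_vecMul_mul_sesq_pow P M i d z (Pi.single i c)
    rwa [hS1, hS2, hS3] at h
  have hpg : ∀ c : ℂ, PolyGrowth fun z : ι → ℂ =>
      star c * P i i * sesq M z z ^ d + (star z ᵥ* P) i *
        (d * sesq M z z ^ (d - 1) * (star c * (M *ᵥ z) i + (star z ᵥ* M) i * c)) := fun c =>
    ((hq d).const_mul (star c * P i i)).add ((polyGrowth_vecMul P i).mul
      (((hq (d - 1)).const_mul d).mul (((polyGrowth_mulVec M i).const_mul (star c)).add
        ((polyGrowth_vecMul M i).mul (PolyGrowth.const c)))))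
  rw [integral_apply_mul i ((polyGrowth_vecMul P i).mul (hq d)) (hpg 1) (hpg Complex.I) (hder 1)
    (hder Complex.I)]
  refine integral_congr_ae (Filter.Eventually.of_forall fun z => ?_)
  simp only [star_one, Complex.star_def, Complex.conj_I]
  linear_combination (1 / 2 * P i i * sesq M z z ^ d * (-1) + 1 / 2 * (star z ᵥ* P) i *
    (d * sesq M z z ^ (d - 1)) * ((star z ᵥ* M) i - (M *ᵥ z) i)) * Complex.I_mul_I

/-- Wick's rule for the complex Gaussian measure: contraction of a factor `z̄ P z` against a power
of `z̄ M z`. -/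
theorem integral_sesq_mul_sesq_pow (P M : Matrix ι ι ℂ) (d : ℕ) :
    ∫ z, sesq P z z * sesq M z z ^ d ∂(cGauss ι) =
      P.trace * ∫ z, sesq M z z ^ d ∂(cGauss ι) +
        d * ∫ z, sesq (P * M) z z * sesq M z z ^ (d - 1) ∂(cGauss ι) := by
  have hq := fun n => (polyGrowth_sesq M).pow n
  have hsum : ∀ z : ι → ℂ, sesq P z z * sesq M z z ^ d =
      ∑ i, z i * ((star z ᵥ* P) i * sesq M z z ^ d) := by
    intro z
    rw [sesq, dotProduct_mulVec, dotProduct, Finset.sum_mul]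
    exact Finset.sum_congr rfl fun i _ => by ring
  simp only [hsum]
  rw [integral_finsetSum]
  · simp only [integral_apply_mul_vecMul]
    rw [← integral_finsetSum]
    · rw [← integral_const_mul, ← integral_const_mul, ← integral_add]
      · refine integral_congr_ae (Filter.Eventually.of_forall fun z => ?_)
        simp only
        rw [Finset.sum_add_distrib, ← Finset.sum_mul, ← Finset.mul_sum, ← Finset.sum_mul]
        congr 3
        rw [sesq, ← mulVec_mulVec, dotProduct_mulVec]
        rfl
      · exact ((hq d).const_mul _).integrable_cGauss
      · exact (((polyGrowth_sesq _).mul (hq (d - 1))).const_mul _).integrable_cGauss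
    · intro i _
      exact (((hq d).const_mul _).add ((((polyGrowth_vecMul P i).mul
        (polyGrowth_mulVec M i)).mul (hq (d - 1))).const_mul _)).integrable_cGauss
  · intro i _
    exact ((polyGrowth_apply i).mul ((polyGrowth_vecMul P i).mul (hq d))).integrable_cGauss

/-- The moments of `z̄ M z` are the complete homogeneous symmetric functions of the eigenvalues
of `M`: both sides satisfy Newton's identities. -/
theorem integral_sesq_pow {κ : Type*} [Fintype κ] [DecidableEq κ] (M : Matrix ι ι ℂ) (x : κ → ℂ)
    (hx : ∀ k, (M ^ (k + 1)).trace = ∑ i, x i ^ (k + 1)) (d : ℕ) :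
    ∫ z, sesq M z z ^ d ∂(cGauss ι) = d.factorial * hs x d := by
  set u : ℕ → ℂ := fun d => (d.factorial : ℂ)⁻¹ * ∫ z, sesq M z z ^ d ∂(cGauss ι) with hu
  have hfac : ∀ d : ℕ, (d.factorial : ℂ) ≠ 0 := fun d => Nat.cast_ne_zero.2 d.factorial_ne_zero
  -- iterating Wick's rule produces all powers of `M`
  have hrec : ∀ (d k : ℕ), (d.factorial : ℂ)⁻¹ *
      ∫ z, sesq (M ^ (k + 1)) z z * sesq M z z ^ d ∂(cGauss ι) =
      ∑ p ∈ Finset.HasAntidiagonal.antidiagonal d, (M ^ (k + p.1 + 1)).trace * u p.2 := by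
    intro d
    induction d with
    | zero =>
      intro k
      rw [integral_sesq_mul_sesq_pow]
      simp [hu]
    | succ d ih =>
      intro k
      rw [integral_sesq_mul_sesq_pow, Finset.Nat.sum_antidiagonal_succ, ← pow_succ,
        Nat.add_sub_cancel]
      have h1 := ih (k + 1)
      have h2 : ∑ p ∈ Finset.HasAntidiagonal.antidiagonal d,
          (M ^ (k + (p.1 + 1) + 1)).trace * u p.2 =
          ∑ p ∈ Finset.HasAntidiagonal.antidiagonal d,
            (M ^ (k + 1 + p.1 + 1)).trace * u p.2 :=
        Finset.sum_congr rfl fun p _ => by rw [show k + (p.1 + 1) + 1 = k + 1 + p.1 + 1 by ring]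
      rw [h2, ← h1]
      simp only [hu, add_zero]
      rw [Nat.factorial_succ]
      have := hfac d
      have h3 : ((d + 1 : ℕ) : ℂ) ≠ 0 := Nat.cast_ne_zero.2 (by omega)
      push_cast at h3 ⊢
      field_simp
  have h := eq_hs_of_newton x u (by simp [hu]) (fun d => by
    have h1 := hrec d 0
    simp only [zero_add, pow_one, ← pow_succ', hx] at h1
    rw [← h1]
    simp only [hu]
    rw [Nat.factorial_succ]
    have := hfac d
    have h3 : ((d + 1 : ℕ) : ℂ) ≠ 0 := Nat.cast_ne_zero.2 (by omega)
    push_cast at h3 ⊢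
    field_simp) d
  rw [← h]
  simp only [hu]
  rw [mul_inv_cancel_left₀ (hfac d)]

end ComplexGaussian

/-! ### Moments of the Gaussian measure on Hermitian matrices -/

section GUE

variable {N : ℕ}

theorem coordMatrix_add (c d : HermCoord N) :
    coordMatrix (c + d) = coordMatrix c + coordMatrix d := by
  ext i j
  simp only [coordMatrix, Matrix.of_apply, Matrix.add_apply]
  split_ifs <;> simp

theorem coordMatrix_smul (r : ℝ) (c : HermCoord N) :
    coordMatrix (r • c) = r • coordMatrix c := by
  ext i j
  simp only [coordMatrix, Matrix.of_apply, Matrix.smul_apply]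
  split_ifs <;> simp

/-- The real-linear map from coordinates to matrices. -/
def coordLin (N : ℕ) : HermCoord N →ₗ[ℝ] Matrix (Fin N) (Fin N) ℂ where
  toFun := coordMatrix
  map_add' := coordMatrix_add
  map_smul' := coordMatrix_smul

theorem coordMatrix_conjTranspose (c : HermCoord N) : (coordMatrix c)ᴴ = coordMatrix c :=
  selfAdjoint.mem_iff.1 (coordMatrix_mem c)

theorem exists_coordMatrix_eq {V : Matrix (Fin N) (Fin N) ℂ} (hV : Vᴴ = V) :
    ∃ v : HermCoord N, coordMatrix v = V := by
  have hV' : ∀ i j, star (V i j) = V j i := fun i j => by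
    rw [← Matrix.conjTranspose_apply, hV]
  refine ⟨(fun i => (V i i).re, fun p => V p.1.1 p.1.2), ?_⟩
  ext i j
  rcases lt_trichotomy i j with h | h | h
  · simp [coordMatrix, h]
  · subst h
    have h1 := hV' i i
    simp only [coordMatrix, Matrix.of_apply, lt_irrefl, dif_neg, not_false_eq_true]
    exact Complex.conj_eq_iff_re.1 h1
  · simp only [coordMatrix, Matrix.of_apply, h.not_gt, dif_neg, not_false_eq_true, h, dif_pos]
    exact hV' j i

theorem trace_linear (X : Matrix (Fin N) (Fin N) ℂ) :
    ∃ l : HermCoord N →ₗ[ℝ] ℂ, ∀ c, l c = (coordMatrix c * X).trace :=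
  ⟨((Matrix.traceLinearMap (Fin N) ℂ ℂ).restrictScalars ℝ) ∘ₗ
    ((LinearMap.mulRight ℂ X).restrictScalars ℝ) ∘ₗ coordLin N, fun _ => rfl⟩

/-- The quadratic form `(N / 2) tr (H H†)` in coordinates, as a bilinear form. -/
def gueForm (N : ℕ) : LinearMap.BilinForm ℝ (HermCoord N) :=
  LinearMap.mk₂ ℝ
    (fun c v => (N : ℝ) / 2 * (Matrix.trace (coordMatrix c * (coordMatrix v)ᴴ)).re)
    (fun c c' v => by
      rw [coordMatrix_add, Matrix.add_mul, Matrix.trace_add, Complex.add_re]; ring)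
    (fun r c v => by
      rw [coordMatrix_smul, Matrix.smul_mul, Matrix.trace_smul, Complex.smul_re, smul_eq_mul,
        smul_eq_mul]; ring)
    (fun c v v' => by
      rw [coordMatrix_add, Matrix.conjTranspose_add, Matrix.mul_add, Matrix.trace_add,
        Complex.add_re]; ring)
    (fun r c v => by
      rw [coordMatrix_smul, Matrix.conjTranspose_smul, Matrix.mul_smul, Matrix.trace_smul,
        star_trivial, Complex.smul_re, smul_eq_mul, smul_eq_mul]; ring)

theorem gueForm_apply (c v : HermCoord N) :
    gueForm N c v = (N : ℝ) / 2 * (Matrix.trace (coordMatrix c * (coordMatrix v)ᴴ)).re := rfl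

theorem gueForm_symm (c v : HermCoord N) : gueForm N c v = gueForm N v c := by
  rw [gueForm_apply, gueForm_apply, coordMatrix_conjTranspose, coordMatrix_conjTranspose,
    Matrix.trace_mul_comm]

theorem ofReal_gueForm (c v : HermCoord N) :
    ((2 * gueForm N c v : ℝ) : ℂ) = N * (coordMatrix c * coordMatrix v).trace := by
  have h : star (coordMatrix c * coordMatrix v).trace = (coordMatrix c * coordMatrix v).trace := by
    rw [← Matrix.trace_conjTranspose, Matrix.conjTranspose_mul, coordMatrix_conjTranspose,
      coordMatrix_conjTranspose, Matrix.trace_mul_comm]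
  rw [gueForm_apply, coordMatrix_conjTranspose]
  conv_rhs => rw [← Complex.conj_eq_iff_re.1 h]
  push_cast
  ring

/-- The Gaussian weight is coercive in the coordinates, for the supremum norm. -/
theorem norm_sq_le_gueForm [NeZero N] (c : HermCoord N) :
    (N : ℝ) / 2 * ‖c‖ ^ 2 ≤ gueForm N c c := by
  have h1 : (Matrix.trace (coordMatrix c * (coordMatrix c)ᴴ)).re =
      ∑ q : Fin N × Fin N, ‖coordMatrix c q.1 q.2‖ ^ 2 := by
    rw [Fintype.sum_prod_type]
    simp only [Matrix.trace, Matrix.diag, Matrix.mul_apply, Matrix.conjTranspose_apply,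
      Complex.re_sum]
    refine Finset.sum_congr rfl fun i _ => Finset.sum_congr rfl fun j _ => ?_
    rw [← Complex.normSq_eq_norm_sq, ← Complex.ofReal_re (Complex.normSq _), ← Complex.mul_conj]
    rfl
  rw [gueForm_apply, h1]
  refine mul_le_mul_of_nonneg_left ?_ (by positivity)
  set S := ∑ q : Fin N × Fin N, ‖coordMatrix c q.1 q.2‖ ^ 2
  have hS : 0 ≤ S := Finset.sum_nonneg fun q _ => by positivity
  have hle : ∀ i j, ‖coordMatrix c i j‖ ≤ Real.sqrt S := fun i j =>
    Real.le_sqrt_of_sq_le (Finset.single_le_sum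
      (f := fun q : Fin N × Fin N => ‖coordMatrix c q.1 q.2‖ ^ 2)
      (fun j _ => by positivity) (Finset.mem_univ (i, j)))
  have h2 : ‖c‖ ≤ Real.sqrt S := by
    rw [Prod.norm_def]
    refine max_le ((pi_norm_le_iff_of_nonneg (Real.sqrt_nonneg _)).2 fun i => ?_)
      ((pi_norm_le_iff_of_nonneg (Real.sqrt_nonneg _)).2 fun p => ?_)
    · have := hle i i
      simpa [coordMatrix] using this
    · have := hle p.1.1 p.1.2
      simpa [coordMatrix, p.2] using this
  calc ‖c‖ ^ 2 ≤ Real.sqrt S ^ 2 := pow_le_pow_left₀ (norm_nonneg _) h2 2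
    _ = S := Real.sq_sqrt hS

theorem half_pos_of_neZero [NeZero N] : (0 : ℝ) < (N : ℝ) / 2 :=
  half_pos (Nat.cast_pos.2 (NeZero.pos N))

instance (N : ℕ) : (volume : Measure (HermCoord N)).IsAddHaarMeasure :=
  have _ : (volume : Measure (Fin N → ℝ)).IsAddHaarMeasure := inferInstance
  have _ : (volume : Measure ({p : Fin N × Fin N // p.1 < p.2} → ℂ)).IsAddHaarMeasure :=
    inferInstance
  Measure.prod.instIsAddHaarMeasure _ _

/-- The Gaussian measure on Hermitian matrices is a Gaussian measure in the coordinates. -/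
theorem gue_eq_map (N : ℕ) : gue N = (gaussian volume (gueForm N)).map ofCoord := by
  set F : HermMat N → ℝ := fun H =>
    -((N : ℝ) / 2) * (Matrix.trace ((H : Matrix (Fin N) (Fin N) ℂ) * (H : Matrix _ _ ℂ)ᴴ)).re
    with hF
  have hFc : Continuous F := by
    have h : Continuous fun H : HermMat N =>
        ((H : Matrix (Fin N) (Fin N) ℂ) * (H : Matrix _ _ ℂ)ᴴ) :=
      continuous_subtype_val.mul continuous_subtype_val.matrix_conjTranspose
    exact continuous_const.mul (Complex.continuous_re.comp h.matrix_trace)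
  have hFB : ∀ c : HermCoord N, F (ofCoord c) = -gueForm N c c := fun c => by
    rw [gueForm_apply, hF, ← neg_mul]
    rfl
  ext s hs
  rw [Measure.map_apply measurable_ofCoord hs, gaussian, gue,
    tilted_apply' _ _ hs, tilted_apply' _ _ (measurable_ofCoord hs), flatMeasure,
    integral_map (f := fun H => Real.exp (F H)) measurable_ofCoord.aemeasurable
      (Real.continuous_exp.comp hFc).measurable.aestronglyMeasurable,
    setLIntegral_map hs ?_ measurable_ofCoord]
  · simp only [← hFB]
    rfl
  · exact ((Real.continuous_exp.comp hFc).div_const _).measurable.ennreal_ofReal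

theorem polyGrowth_coordMatrix (i j : Fin N) : PolyGrowth fun c : HermCoord N => coordMatrix c i j :=
  PolyGrowth.linear (((LinearMap.proj j : (Fin N → ℂ) →ₗ[ℂ] ℂ) ∘ₗ
    (LinearMap.proj i : (Fin N → Fin N → ℂ) →ₗ[ℂ] (Fin N → ℂ))).restrictScalars ℝ ∘ₗ coordLin N)

theorem continuous_eval_entries (q : MvPolynomial (Fin N × Fin N) ℂ) :
    Continuous fun H : Matrix (Fin N) (Fin N) ℂ => MvPolynomial.eval (fun p => H p.1 p.2) q := by
  refine (MvPolynomial.continuous_eval q).comp ?_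
  fun_prop

theorem integral_gue {φ : Matrix (Fin N) (Fin N) ℂ → ℂ} (hφ : Continuous φ) :
    ∫ H : HermMat N, φ H ∂(gue N) = ∫ c, φ (coordMatrix c) ∂(gaussian volume (gueForm N)) := by
  rw [gue_eq_map, integral_map (f := fun H : HermMat N => φ H) measurable_ofCoord.aemeasurable
    (hφ.comp continuous_subtype_val).measurable.aestronglyMeasurable]
  rfl

theorem integrable_gue_iff {φ : Matrix (Fin N) (Fin N) ℂ → ℂ} (hφ : Continuous φ) :
    Integrable (fun H : HermMat N => φ H) (gue N) ↔
      Integrable (fun c => φ (coordMatrix c)) (gaussian volume (gueForm N)) := by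
  rw [gue_eq_map]
  exact integrable_map_measure (f := ofCoord) (g := fun H : HermMat N => φ H)
    (hφ.comp continuous_subtype_val).measurable.aestronglyMeasurable
    measurable_ofCoord.aemeasurable

theorem integrable_gue [NeZero N] {φ : Matrix (Fin N) (Fin N) ℂ → ℂ} (hφ : Continuous φ)
    (h : PolyGrowth fun c : HermCoord N => φ (coordMatrix c)) :
    Integrable (fun H : HermMat N => φ H) (gue N) :=
  (integrable_gue_iff hφ).2 (h.integrable half_pos_of_neZero norm_sq_le_gueForm)

theorem polyGrowth_trace (X : Matrix (Fin N) (Fin N) ℂ) :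
    PolyGrowth fun c : HermCoord N => (coordMatrix c * X).trace := by
  obtain ⟨l, hl⟩ := trace_linear X
  exact (congrArg PolyGrowth (funext hl)).mp (PolyGrowth.linear l)

theorem integrable_trace_pow [NeZero N] (X : Matrix (Fin N) (Fin N) ℂ) {f : HermCoord N → ℂ}
    (hf : PolyGrowth f) (d : ℕ) :
    Integrable (fun c => f c * (coordMatrix c * X).trace ^ d) (gaussian volume (gueForm N)) :=
  (hf.mul ((polyGrowth_trace X).pow d)).integrable half_pos_of_neZero norm_sq_le_gueForm

/-- Wick's rule for the Gaussian measure on Hermitian matrices. -/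
theorem integral_trace_mul_trace_pow [NeZero N] (V X : Matrix (Fin N) (Fin N) ℂ) (d : ℕ) :
    N * ∫ c, (coordMatrix c * V).trace * (coordMatrix c * X).trace ^ d
        ∂(gaussian volume (gueForm N)) =
      d * (V * X).trace *
        ∫ c, (coordMatrix c * X).trace ^ (d - 1) ∂(gaussian volume (gueForm N)) := by
  -- the Hermitian case is integration by parts along the direction `V`
  have herm : ∀ V : Matrix (Fin N) (Fin N) ℂ, Vᴴ = V →
      N * ∫ c, (coordMatrix c * V).trace * (coordMatrix c * X).trace ^ d
        ∂(gaussian volume (gueForm N)) =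
      d * (V * X).trace *
        ∫ c, (coordMatrix c * X).trace ^ (d - 1) ∂(gaussian volume (gueForm N)) := by
    intro V hV
    obtain ⟨v, rfl⟩ := exists_coordMatrix_eq hV
    obtain ⟨l, hl⟩ := trace_linear X
    have hder : ∀ c, HasLineDerivAt ℝ (fun c => (coordMatrix c * X).trace ^ d)
        (d * (coordMatrix v * X).trace * (coordMatrix c * X).trace ^ (d - 1)) c v := by
      intro c
      simp only [← hl]
      unfold HasLineDerivAt
      have h1 : ∀ t : ℝ, l (c + t • v) = l c + (t : ℂ) * l v := fun t => by
        rw [map_add, map_smul, Complex.real_smul]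
      simp only [h1]
      have h4 : HasDerivAt (fun t : ℝ => (t : ℂ)) 1 0 := Complex.ofRealCLM.hasDerivAt
      refine (((h4.mul_const (l v)).const_add (l c)).pow d).congr_deriv ?_
      simp
      ring
    have h := integral_bilin_mul (m := volume) half_pos_of_neZero norm_sq_le_gueForm gueForm_symm v
      ((polyGrowth_trace X).pow d) (((polyGrowth_trace X).pow (d - 1)).const_mul
        (d * (coordMatrix v * X).trace)) hder
    simp only [ofReal_gueForm, mul_assoc] at h
    rw [integral_const_mul] at h
    rw [h, mul_assoc, ← integral_const_mul, ← integral_const_mul]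
  -- both sides are complex linear in `V`
  obtain ⟨V₁, V₂, h₁, h₂, rfl⟩ : ∃ V₁ V₂ : Matrix (Fin N) (Fin N) ℂ, V₁ᴴ = V₁ ∧ V₂ᴴ = V₂ ∧
      V = V₁ + Complex.I • V₂ :=
    ⟨realPart V, imaginaryPart V, (realPart V).2, (imaginaryPart V).2,
      (realPart_add_I_smul_imaginaryPart V).symm⟩
  have e₁ := herm V₁ h₁
  have e₂ := herm V₂ h₂
  have hexp : ∀ c : HermCoord N,
      (coordMatrix c * (V₁ + Complex.I • V₂)).trace * (coordMatrix c * X).trace ^ d =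
      (coordMatrix c * V₁).trace * (coordMatrix c * X).trace ^ d +
        Complex.I * ((coordMatrix c * V₂).trace * (coordMatrix c * X).trace ^ d) := by
    intro c
    rw [Matrix.mul_add, Matrix.mul_smul, Matrix.trace_add, Matrix.trace_smul, smul_eq_mul]
    ring
  simp only [hexp]
  rw [integral_add (integrable_trace_pow X (polyGrowth_trace V₁) d)
    ((integrable_trace_pow X (polyGrowth_trace V₂) d).const_mul _), integral_const_mul,
    Matrix.add_mul, Matrix.smul_mul, Matrix.trace_add, Matrix.trace_smul, smul_eq_mul]
  linear_combination e₁ + Complex.I * e₂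

/-- The moments of the linear statistic `tr (H X)` depend on `X` only through `tr (X ^ 2)`. -/
theorem integral_trace_pow_congr [NeZero N] {X Y : Matrix (Fin N) (Fin N) ℂ}
    (h : (X * X).trace = (Y * Y).trace) (d : ℕ) :
    ∫ c, (coordMatrix c * X).trace ^ d ∂(gaussian volume (gueForm N)) =
      ∫ c, (coordMatrix c * Y).trace ^ d ∂(gaussian volume (gueForm N)) := by
  have hN : (N : ℂ) ≠ 0 := Nat.cast_ne_zero.2 (NeZero.ne N)
  induction d using Nat.strong_induction_on with
  | _ d ih =>
    cases d with
    | zero => simp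
    | succ d =>
      have hX := integral_trace_mul_trace_pow X X d
      have hY := integral_trace_mul_trace_pow Y Y d
      simp only [← pow_succ'] at hX hY
      refine mul_left_cancel₀ hN ?_
      rw [hX, hY, h]
      rcases Nat.eq_zero_or_pos d with rfl | hd
      · simp
      · rw [ih (d - 1) (by omega)]

end GUE

/-! ### Symmetry of the averaged Cauchy kernel -/

section Kernel

theorem polyGrowth_one_add_norm_pow {E : Type*} [NormedAddCommGroup E] (k : ℕ) :
    PolyGrowth fun x : E => (((1 + ‖x‖) ^ k : ℝ) : ℂ) := by
  refine ⟨Complex.continuous_ofReal.comp (by fun_prop), 1, k, fun x => ?_⟩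
  rw [Complex.norm_real, Real.norm_of_nonneg (by positivity), one_mul]

/-- Functions of polynomial growth on a product space are integrable for the product of two
measures which integrate all functions of polynomial growth. -/
theorem PolyGrowth.integrable_prod {E F : Type*} [NormedAddCommGroup E] [NormedAddCommGroup F]
    [MeasurableSpace E] [BorelSpace E] [SecondCountableTopology E]
    [MeasurableSpace F] [BorelSpace F] [SecondCountableTopology F]
    {μ : Measure E} {ν : Measure F} [SFinite μ] [SFinite ν]
    (hμ : ∀ f : E → ℂ, PolyGrowth f → Integrable f μ)
    (hν : ∀ f : F → ℂ, PolyGrowth f → Integrable f ν) {f : E × F → ℂ} (hf : PolyGrowth f) :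
    Integrable f (μ.prod ν) := by
  obtain ⟨C, k, hC, h⟩ := hf.exists_nonneg
  refine (((hμ _ (polyGrowth_one_add_norm_pow k)).norm.mul_prod
    (hν _ (polyGrowth_one_add_norm_pow k)).norm).const_mul C).mono'
    hf.1.aestronglyMeasurable (Filter.Eventually.of_forall fun p => (h p).trans ?_)
  rw [Complex.norm_real, Complex.norm_real, Real.norm_of_nonneg (by positivity),
    Real.norm_of_nonneg (by positivity), ← mul_pow]
  refine mul_le_mul_of_nonneg_left (pow_le_pow_left₀ (by positivity) ?_ k) hC
  have h1 : ‖p‖ ≤ ‖p.1‖ + ‖p.2‖ := by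
    rw [Prod.norm_def]
    exact max_le_add_of_nonneg (norm_nonneg _) (norm_nonneg _)
  nlinarith [mul_nonneg (norm_nonneg p.1) (norm_nonneg p.2)]

variable {N : ℕ}

theorem trace_kronecker_pow (A B : Matrix (Fin N) (Fin N) ℂ) (k : ℕ) :
    ((Matrix.kronecker A B) ^ k).trace =
      ∑ p : Fin N × Fin N, (eigenvalueList A p.1 * eigenvalueList B p.2) ^ k := by
  have h : (Matrix.kronecker A B) ^ k = Matrix.kronecker (A ^ k) (B ^ k) := by
    induction k with
    | zero => simp [Matrix.kronecker]
    | succ k ih =>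
      rw [pow_succ, ih, pow_succ, pow_succ]
      exact (Matrix.mul_kronecker_mul _ _ _ _).symm
  have h2 : (Matrix.kronecker (A ^ k) (B ^ k)).trace = (A ^ k).trace * (B ^ k).trace :=
    Matrix.trace_kronecker _ _
  rw [h, h2, ← sum_eigenvalueList_pow, ← sum_eigenvalueList_pow,
    Finset.sum_mul_sum, Fintype.sum_prod_type]
  simp only [mul_pow]

/-- The quadratic form of a Kronecker product, in terms of the matrix `Z` with entries `z (i, k)`. -/
theorem sesq_kronecker (A B : Matrix (Fin N) (Fin N) ℂ) (z : Fin N × Fin N → ℂ) :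
    sesq (Matrix.kronecker A B) z z =
      ((Matrix.of fun i k => z (i, k))ᴴ * A * (Matrix.of fun i k => z (i, k)) * Bᵀ).trace := by
  simp only [sesq, dotProduct, mulVec, Fintype.sum_prod_type, Matrix.trace, Matrix.diag,
    Matrix.mul_apply, Matrix.conjTranspose_apply, Matrix.transpose_apply, Matrix.of_apply,
    Matrix.kronecker, Matrix.kroneckerMap_apply, Pi.star_apply, Finset.sum_mul, Finset.mul_sum]
  rw [Finset.sum_comm]
  refine Finset.sum_congr rfl fun k _ => ?_
  have h : ∀ i, ∑ j, ∑ l, star (z (i, k)) * (A i j * B k l * z (j, l)) =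
      ∑ l, ∑ j, star (z (i, k)) * A i j * z (j, l) * B k l := by
    intro i
    rw [Finset.sum_comm]
    exact Finset.sum_congr rfl fun l _ => Finset.sum_congr rfl fun j _ => by ring
  simp only [h]
  rw [Finset.sum_comm]
  exact Finset.sum_congr rfl fun l _ => Finset.sum_comm

theorem PolyGrowth.comp_fst {E F : Type*} [NormedAddCommGroup E] [NormedAddCommGroup F]
    {f : E → ℂ} (hf : PolyGrowth f) : PolyGrowth fun p : E × F => f p.1 := by
  obtain ⟨C, k, hC, h⟩ := hf.exists_nonneg
  refine ⟨hf.1.comp continuous_fst, C, k, fun p => (h p.1).trans ?_⟩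
  gcongr
  exact norm_fst_le p

theorem polyGrowth_sesq_prod {E ι : Type*} [NormedAddCommGroup E] [Fintype ι]
    {M : E → Matrix ι ι ℂ} (hM : ∀ i j, PolyGrowth fun e => M e i j) :
    PolyGrowth fun p : E × (ι → ℂ) => sesq (M p.1) p.2 p.2 := by
  have h2 : ∀ q, PolyGrowth fun p : E × (ι → ℂ) => p.2 q := fun q =>
    ⟨by fun_prop, 1, 1, fun p => by
      have := (norm_le_pi_norm p.2 q).trans (norm_snd_le p)
      rw [pow_one, one_mul]
      linarith⟩
  have h3 : ∀ q, PolyGrowth fun p : E × (ι → ℂ) => star (p.2 q) := fun q =>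
    ⟨by fun_prop, 1, 1, fun p => by
      have := (norm_le_pi_norm p.2 q).trans (norm_snd_le p)
      rw [pow_one, one_mul, norm_star]
      linarith⟩
  exact PolyGrowth.sum fun q _ => (h3 q).mul (PolyGrowth.sum fun r _ =>
    ((hM q r).comp_fst).mul (h2 r))

theorem polyGrowth_mul_coordMatrix (A : Matrix (Fin N) (Fin N) ℂ) (i j : Fin N) :
    PolyGrowth fun c : HermCoord N => (A * coordMatrix c) i j := by
  simpa only [Matrix.mul_apply] using
    PolyGrowth.sum fun l _ => (polyGrowth_coordMatrix l j).const_mul (A i l)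

/-- The Gaussian measure on Hermitian matrices in coordinates. -/
abbrev gueCoord (N : ℕ) : Measure (HermCoord N) := gaussian volume (gueForm N)

instance [NeZero N] : IsProbabilityMeasure (gueCoord N) :=
  isProbabilityMeasure_gaussian half_pos_of_neZero norm_sq_le_gueForm

/-- The moments of the Kronecker products are complete homogeneous symmetric functions of products
of eigenvalues. -/
theorem integral_sesq_kronecker_pow (A B : Matrix (Fin N) (Fin N) ℂ) (d : ℕ) :
    ∫ z, sesq (Matrix.kronecker A B) z z ^ d ∂(cGauss (Fin N × Fin N)) =
      d.factorial *
        hs (fun p : Fin N × Fin N => eigenvalueList A p.1 * eigenvalueList B p.2) d :=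
  integral_sesq_pow _ _ (fun k => trace_kronecker_pow A B (k + 1)) d

theorem sesq_mul_kronecker (A B X : Matrix (Fin N) (Fin N) ℂ) (z : Fin N × Fin N → ℂ) :
    sesq (Matrix.kronecker (A * X) B) z z =
      (X * ((Matrix.of fun i k => z (i, k)) * Bᵀ *
        (Matrix.of fun i k => z (i, k))ᴴ * A)).trace := by
  rw [sesq_kronecker, Matrix.mul_assoc, Matrix.mul_assoc, Matrix.mul_assoc,
    Matrix.trace_mul_comm, Matrix.mul_assoc, Matrix.mul_assoc, Matrix.trace_mul_comm]
  simp only [Matrix.mul_assoc]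

theorem sesq_kronecker_mul (A B X : Matrix (Fin N) (Fin N) ℂ) (z : Fin N × Fin N → ℂ) :
    sesq (Matrix.kronecker A (B * X)) z z =
      (X * (Bᵀ * (Matrix.of fun i k => z (i, k))ᴴ * A *
        (Matrix.of fun i k => z (i, k)))ᵀ).trace := by
  rw [sesq_kronecker, Matrix.transpose_mul B, ← Matrix.trace_transpose (X * _),
    Matrix.transpose_mul X, Matrix.transpose_transpose, ← Matrix.mul_assoc,
    Matrix.trace_mul_comm]
  simp only [Matrix.mul_assoc]

/-- With `Z` fixed, both quadratic forms are traces of `H` against matrices `X`, `Y` with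
`tr (X ^ 2) = tr (Y ^ 2)`, so they have the same moments. -/
theorem integral_sesq_kronecker_comm [NeZero N] (A B : Matrix (Fin N) (Fin N) ℂ) (d : ℕ)
    (z : Fin N × Fin N → ℂ) :
    ∫ c, sesq (Matrix.kronecker (A * coordMatrix c) B) z z ^ d ∂(gueCoord N) =
      ∫ c, sesq (Matrix.kronecker A (B * coordMatrix c)) z z ^ d ∂(gueCoord N) := by
  simp only [sesq_mul_kronecker, sesq_kronecker_mul]
  refine integral_trace_pow_congr ?_ d
  rw [← Matrix.transpose_mul, Matrix.trace_transpose]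
  simp only [Matrix.mul_assoc]
  rw [Matrix.trace_mul_comm]
  simp only [Matrix.mul_assoc]

theorem integral_integral_sesq_swap [NeZero N]
    {M : HermCoord N → Matrix (Fin N × Fin N) (Fin N × Fin N) ℂ}
    (hM : ∀ i j, PolyGrowth fun c => M c i j) (d : ℕ) :
    ∫ c, ∫ z, sesq (M c) z z ^ d ∂(cGauss (Fin N × Fin N)) ∂(gueCoord N) =
      ∫ z, ∫ c, sesq (M c) z z ^ d ∂(gueCoord N) ∂(cGauss (Fin N × Fin N)) :=
  integral_integral_swap (f := fun c z => sesq (M c) z z ^ d)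
    (PolyGrowth.integrable_prod
      (fun _ hf => hf.integrable half_pos_of_neZero norm_sq_le_gueForm)
      (fun _ hf => hf.integrable_cGauss) ((polyGrowth_sesq_prod hM).pow d))

/-- Under the average over `H`, the factor `H` may be moved from `A` to `B` in the Cauchy kernel of
`A` and `B`. -/
theorem integral_hs_mul_comm [NeZero N] (A B : Matrix (Fin N) (Fin N) ℂ) (d : ℕ) :
    ∫ c, hs (fun p : Fin N × Fin N =>
        eigenvalueList (A * coordMatrix c) p.1 * eigenvalueList B p.2) d ∂(gueCoord N) =
      ∫ c, hs (fun p : Fin N × Fin N =>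
        eigenvalueList A p.1 * eigenvalueList (B * coordMatrix c) p.2) d ∂(gueCoord N) := by
  -- write both kernels as moments over `z`, then exchange the averages over `z` and `H`
  refine mul_left_cancel₀ (Nat.cast_ne_zero.2 d.factorial_ne_zero : (d.factorial : ℂ) ≠ 0) ?_
  rw [← integral_const_mul, ← integral_const_mul]
  simp only [← integral_sesq_kronecker_pow]
  rw [integral_integral_sesq_swap (M := fun c => Matrix.kronecker (A * coordMatrix c) B)
      fun q r => (polyGrowth_mul_coordMatrix A q.1 r.1).mul (PolyGrowth.const (B q.2 r.2)),
    integral_integral_sesq_swap (M := fun c => Matrix.kronecker A (B * coordMatrix c))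
      fun q r => (polyGrowth_mul_coordMatrix B q.2 r.2).const_mul (A q.1 r.1)]
  simp only [integral_sesq_kronecker_comm]

end Kernel

/-! ### Averaged Schur functions -/

section Average

variable {N : ℕ}

/-- The average of the product of complete homogeneous functions `h_{a_1} ⋯ h_{a_N}` over the
eigenvalues of `A H`. -/
def hsMoment (A : Matrix (Fin N) (Fin N) ℂ) (a : Fin N →₀ ℕ) : ℂ :=
  ∫ c, ∏ j, hs (eigenvalueList (A * coordMatrix c)) (a j) ∂(gueCoord N)

theorem integrable_prod_hs [NeZero N] (A : Matrix (Fin N) (Fin N) ℂ) (a : Fin N →₀ ℕ) :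
    Integrable (fun c => ∏ j, hs (eigenvalueList (A * coordMatrix c)) (a j)) (gueCoord N) := by
  choose q hq using exists_eval_eq_hs N
  have h : PolyGrowth fun c : HermCoord N =>
      MvPolynomial.eval (fun p => (A * coordMatrix c) p.1 p.2) (∏ j, q (a j)) :=
    PolyGrowth.eval (fun p : Fin N × Fin N => polyGrowth_mul_coordMatrix A p.1 p.2) _
  simp only [map_prod, ← hq] at h
  exact h.integrable half_pos_of_neZero norm_sq_le_gueForm

theorem hs_mul_congr {x x' y y' : Fin N → ℂ} (hx : ∀ k, ∑ i, x i ^ (k + 1) = ∑ i, x' i ^ (k + 1))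
    (hy : ∀ k, ∑ i, y i ^ (k + 1) = ∑ i, y' i ^ (k + 1)) (d : ℕ) :
    hs (fun p : Fin N × Fin N => x p.1 * y p.2) d =
      hs (fun p : Fin N × Fin N => x' p.1 * y' p.2) d := by
  refine hs_congr (fun k => ?_) d
  simp only [mul_pow, Fintype.sum_prod_type, ← Finset.sum_mul_sum, hx, hy]

theorem integral_hs_mul_eq_sum [NeZero N] (A : Matrix (Fin N) (Fin N) ℂ) (b : Fin N → ℂ) (d : ℕ) :
    ∫ c, hs (fun p : Fin N × Fin N => eigenvalueList (A * coordMatrix c) p.1 * b p.2) d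
        ∂(gueCoord N) =
      ∑ a ∈ Finset.univ.finsuppAntidiag d, hsMoment A a * ∏ j, b j ^ a j := by
  simp only [hs_mul_eq_sum]
  rw [integral_finsetSum _ fun a _ => (integrable_prod_hs A a).mul_const _]
  simp only [integral_mul_const, hsMoment]

/-- The symmetry of the averaged Cauchy kernel, expressed by its coefficients. Here `x` and `b` are
the eigenvalues of `A` and `B` in any order. -/
theorem sum_hsMoment_comm [NeZero N] {A B : Matrix (Fin N) (Fin N) ℂ} {x b : Fin N → ℂ}
    (hx : ∀ k, (A ^ (k + 1)).trace = ∑ i, x i ^ (k + 1))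
    (hb : ∀ k, (B ^ (k + 1)).trace = ∑ i, b i ^ (k + 1)) (d : ℕ) :
    ∑ a ∈ Finset.univ.finsuppAntidiag d, hsMoment A a * ∏ j, b j ^ a j =
      ∑ a ∈ Finset.univ.finsuppAntidiag d, hsMoment B a * ∏ j, x j ^ a j := by
  rw [← integral_hs_mul_eq_sum, ← integral_hs_mul_eq_sum]
  have hx' : ∀ k, ∑ i, x i ^ (k + 1) = ∑ i, eigenvalueList A i ^ (k + 1) := fun k => by
    rw [sum_eigenvalueList_pow, hx]
  have hb' : ∀ k, ∑ i, b i ^ (k + 1) = ∑ i, eigenvalueList B i ^ (k + 1) := fun k => by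
    rw [sum_eigenvalueList_pow, hb]
  simp only [hs_mul_congr (fun _ => rfl) hb', hs_mul_congr (fun _ => rfl) hx']
  rw [integral_hs_mul_comm]
  refine integral_congr_ae (Filter.Eventually.of_forall fun c => ?_)
  simp only
  rw [← hs_comp_equiv (Equiv.prodComm _ _)]
  congr 1
  funext p
  exact mul_comm _ _

theorem trace_diagonal_pow (x : Fin N → ℂ) (k : ℕ) :
    ((Matrix.diagonal x) ^ (k + 1)).trace = ∑ i, x i ^ (k + 1) := by
  rw [Matrix.diagonal_pow, Matrix.trace_diagonal]
  rfl

/-- The moments of `A H` depend on `A` through its eigenvalues only. -/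
theorem hsMoment_congr [NeZero N] {A A' : Matrix (Fin N) (Fin N) ℂ}
    (h : ∀ k, (A ^ (k + 1)).trace = (A' ^ (k + 1)).trace) (a : Fin N →₀ ℕ) :
    hsMoment A a = hsMoment A' a := by
  -- compare coefficients in `b`, the eigenvalues of `B = diag b`
  have key : ∑ c ∈ Finset.univ.finsuppAntidiag (∑ j, a j), MvPolynomial.monomial c (hsMoment A c) =
      ∑ c ∈ Finset.univ.finsuppAntidiag (∑ j, a j), MvPolynomial.monomial c (hsMoment A' c) := by
    refine MvPolynomial.funext fun b => ?_
    simp only [map_sum, MvPolynomial.eval_monomial, Finsupp.prod_fintype _ _ fun i => pow_zero _]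
    have hx : ∀ k, (A ^ (k + 1)).trace = ∑ i, eigenvalueList A i ^ (k + 1) :=
      fun k => (sum_eigenvalueList_pow A _).symm
    rw [sum_hsMoment_comm hx (trace_diagonal_pow b),
      sum_hsMoment_comm (fun k => (h k).symm.trans (hx k)) (trace_diagonal_pow b)]
  have hmem : a ∈ (Finset.univ : Finset (Fin N)).finsuppAntidiag (∑ j, a j) := by
    simp [Finset.mem_finsuppAntidiag]
  have h2 := congrArg (MvPolynomial.coeff a) key
  simpa only [MvPolynomial.coeff_sum, MvPolynomial.coeff_monomial, Finset.sum_ite_eq', hmem,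
    if_true] using h2

theorem integral_altSum {Ω : Type*} [MeasurableSpace Ω] {μ : Measure Ω}
    {g : (Fin N →₀ ℕ) → Ω → ℂ} (hg : ∀ a, Integrable (g a) μ) (ν : Fin N →₀ ℕ) :
    ∫ ω, altSum (fun a => g a ω) ν ∂μ = altSum (fun a => ∫ ω, g a ω ∂μ) ν := by
  simp only [altSum]
  rw [integral_finsetSum]
  · refine Finset.sum_congr rfl fun w _ => ?_
    rcases Int.units_eq_one_or (Equiv.Perm.sign w) with h | h <;> rw [h] <;> split_ifs <;>
      simp [integral_neg]
  · intro w _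
    rcases Int.units_eq_one_or (Equiv.Perm.sign w) with h | h <;> rw [h] <;> split_ifs
    · simpa using hg _
    · simp
    · simpa using (hg _).neg
    · simp

/-- The average of a Schur polynomial at the eigenvalues of `A H`. -/
theorem integral_eval_altSum_hPoly [NeZero N] (A : Matrix (Fin N) (Fin N) ℂ) (ν : Fin N →₀ ℕ) :
    ∫ c, MvPolynomial.eval (eigenvalueList (A * coordMatrix c)) (altSum hPoly ν) ∂(gueCoord N) =
      altSum (hsMoment A) ν := by
  have h : ∀ x : Fin N → ℂ, MvPolynomial.eval x (altSum hPoly ν) =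
      altSum (fun a => ∏ j, hs x (a j)) ν := by
    intro x
    refine (map_altSum (MvPolynomial.eval x).toAddMonoidHom hPoly ν).trans ?_
    exact congrArg (altSum · ν) (funext fun a => eval_hPoly a x)
  simp only [h]
  exact integral_altSum (integrable_prod_hs A) ν

/-- The moments of `A H` are polynomials in the eigenvalues of `A`. -/
theorem exists_eval_eq_hsMoment [NeZero N] (a : Fin N →₀ ℕ) :
    ∃ P : MvPolynomial (Fin N) ℂ, ∀ A : Matrix (Fin N) (Fin N) ℂ, ∀ x : Fin N → ℂ,
      (∀ k, (A ^ (k + 1)).trace = ∑ i, x i ^ (k + 1)) → MvPolynomial.eval x P = hsMoment A a := by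
  obtain ⟨ν, hν⟩ : ∃ ν, LexLE (hPoly a) ν := by
    by_cases h0 : hPoly a = 0
    · refine ⟨0, fun β hβ => ?_⟩
      simp [h0] at hβ
    · obtain ⟨κ, -, hκ⟩ := exists_max_exponent h0
      exact ⟨κ, hκ⟩
  obtain ⟨P, -, hP⟩ := exists_lexLE_integral (μ := gueCoord N) (M := coordMatrix)
    (fun q => (PolyGrowth.eval (fun p : Fin N × Fin N => polyGrowth_coordMatrix p.1 p.2)
      q).integrable half_pos_of_neZero norm_sq_le_gueForm) (hPoly_isSymmetric a) hν
  refine ⟨P, fun A x hx => ?_⟩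
  rw [hP]
  simp only [eval_hPoly]
  exact hsMoment_congr (fun k => (trace_diagonal_pow x k).trans (hx k).symm) a

theorem continuous_schur (lam : YoungDiagram) :
    Continuous fun A : Matrix (Fin N) (Fin N) ℂ => schur lam A := by
  obtain ⟨q, hq⟩ := exists_eval_eq_schur N lam
  simp only [hq]
  exact continuous_eval_entries q

/-- Averaging `s_λ(A H)` over `H` multiplies `s_λ(A)` by a constant: the polynomials `p a` giving the
moments of `A H` form a symmetric and triangular family, as do the products `hPoly a`. -/
theorem exists_integral_schur_mul_of_le [NeZero N] (lam : YoungDiagram) (hlam : lam.colLen 0 ≤ N) :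
    ∃ t : ℂ, ∀ A : Matrix (Fin N) (Fin N) ℂ,
      ∫ H : HermMat N, schur lam (A * (H : Matrix (Fin N) (Fin N) ℂ)) ∂(gue N) = t * schur lam A := by
  choose p hp using exists_eval_eq_hsMoment (N := N)
  have heval : ∀ (A : Matrix (Fin N) (Fin N) ℂ) (x : Fin N → ℂ),
      (∀ k, (A ^ (k + 1)).trace = ∑ i, x i ^ (k + 1)) → ∀ ν,
        MvPolynomial.eval x (altSum p ν) = altSum (hsMoment A) ν := by
    intro A x hx ν
    refine (map_altSum (MvPolynomial.eval x).toAddMonoidHom p ν).trans ?_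
    exact congrArg (altSum · ν) (funext fun a => hp a A x hx)
  have hcomm : ∀ a b, (p a).coeff b = (p b).coeff a := by
    refine coeff_comm_of_eval fun d x b => ?_
    simp only [hp _ _ x (trace_diagonal_pow x), hp _ _ b (trace_diagonal_pow b)]
    exact sum_hsMoment_comm (trace_diagonal_pow x) (trace_diagonal_pow b) d
  have hsymm : ∀ a, (p a).IsSymmetric := by
    intro a e
    refine MvPolynomial.funext fun x => ?_
    rw [MvPolynomial.eval_rename, hp a (Matrix.diagonal x) x (trace_diagonal_pow x),
      hp a (Matrix.diagonal x) (x ∘ e)]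
    intro k
    rw [trace_diagonal_pow]
    exact (Equiv.sum_comp e fun i => x i ^ (k + 1)).symm
  have htri : ∀ ν : Fin N →₀ ℕ, Antitone ν → LexLE (altSum p ν) ν := by
    intro ν hν
    obtain ⟨P, hP, hPe⟩ := exists_lexLE_integral (μ := gueCoord N) (M := coordMatrix)
      (fun q => (PolyGrowth.eval (fun p : Fin N × Fin N => polyGrowth_coordMatrix p.1 p.2)
        q).integrable half_pos_of_neZero norm_sq_le_gueForm)
      (altSum_isSymmetric hPoly_isSymmetric ν) (lexLE_altSum_hPoly ν hν)
    have h : altSum p ν = P := MvPolynomial.funext fun x => by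
      rw [hPe, integral_eval_altSum_hPoly, heval _ x (trace_diagonal_pow x)]
    rwa [h]
  set ν : Fin N →₀ ℕ := expo fun i => lam.rowLen i with hνdef
  have hν : Antitone ν := fun i j hij => lam.rowLen_anti i j hij
  have h0 : altSum hPoly ν = 0 → altSum p ν = 0 := by
    intro h
    refine MvPolynomial.funext fun x => ?_
    rw [heval _ x (trace_diagonal_pow x), ← integral_eval_altSum_hPoly, h]
    simp
  obtain ⟨t, ht⟩ := exists_altSum_eq_C_mul hcomm hsymm htri coeff_hPoly_comm hPoly_isSymmetric
    lexLE_altSum_hPoly hν h0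
  have hschur : ∀ A : Matrix (Fin N) (Fin N) ℂ,
      schur lam A = MvPolynomial.eval (eigenvalueList A) (altSum hPoly ν) := fun A => by
    rw [schur_eq_jacobiTrudi lam hlam, jacobiTrudi_eq_eval]
  refine ⟨t, fun A => ?_⟩
  rw [integral_gue (φ := fun H => schur lam (A * H)) ((continuous_schur lam).comp
    (continuous_const.mul continuous_id))]
  simp only [hschur]
  rw [integral_eval_altSum_hPoly,
    ← heval A (eigenvalueList A) (fun k => (sum_eigenvalueList_pow A _).symm), ht, map_mul,
    MvPolynomial.eval_C]

end Average

/-! ### Products of independent matrices -/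

section Product

variable {N : ℕ}

/-- Averaging multiplies `s_λ` by a constant. This includes `N = 0`, where all matrices are equal, and
partitions with more than `N` parts, where `s_λ = 0`. -/
theorem exists_integral_schur_mul (N : ℕ) (lam : YoungDiagram) :
    ∃ t : ℂ, ∀ A : Matrix (Fin N) (Fin N) ℂ,
      ∫ H : HermMat N, schur lam (A * (H : Matrix (Fin N) (Fin N) ℂ)) ∂(gue N) =
        t * schur lam A := by
  rcases lt_or_ge N (lam.colLen 0) with h | h
  · exact ⟨0, fun A => by simp [schur_eq_zero lam h]⟩
  rcases Nat.eq_zero_or_pos N with rfl | hN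
  · refine ⟨1, fun A => ?_⟩
    have hc : ∀ H : HermMat 0, schur lam (A * (H : Matrix (Fin 0) (Fin 0) ℂ)) = schur lam A :=
      fun H => congrArg _ (Subsingleton.elim _ _)
    simp only [hc, integral_const, probReal_univ, one_smul, one_mul]
  · have : NeZero N := ⟨hN.ne'⟩
    exact exists_integral_schur_mul_of_le lam h

/-- A submultiplicative size of a matrix, at least one. -/
def matSize (A : Matrix (Fin N) (Fin N) ℂ) : ℝ := 1 + ∑ i, ∑ j, ‖A i j‖

theorem matSize_mul_le (A B : Matrix (Fin N) (Fin N) ℂ) :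
    matSize (A * B) ≤ matSize A * matSize B := by
  have h1 : ∑ i, ∑ j, ‖(A * B) i j‖ ≤ (∑ i, ∑ j, ‖A i j‖) * ∑ i, ∑ j, ‖B i j‖ := by
    rw [Finset.sum_mul]
    refine Finset.sum_le_sum fun i _ => ?_
    calc ∑ j, ‖(A * B) i j‖ ≤ ∑ j, ∑ k, ‖A i k‖ * ‖B k j‖ := by
          refine Finset.sum_le_sum fun j _ => ?_
          rw [Matrix.mul_apply]
          exact (norm_sum_le _ _).trans_eq (by simp only [norm_mul])
      _ = ∑ k, ‖A i k‖ * ∑ j, ‖B k j‖ := by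
          rw [Finset.sum_comm]
          simp only [Finset.mul_sum]
      _ ≤ (∑ k, ‖A i k‖) * ∑ k, ∑ j, ‖B k j‖ := by
          rw [Finset.sum_mul]
          refine Finset.sum_le_sum fun k _ => mul_le_mul_of_nonneg_left ?_ (norm_nonneg _)
          exact Finset.single_le_sum (f := fun k => ∑ j, ‖B k j‖)
            (fun k _ => by positivity) (Finset.mem_univ k)
  have h2 : 0 ≤ ∑ i, ∑ j, ‖A i j‖ := by positivity
  have h3 : 0 ≤ ∑ i, ∑ j, ‖B i j‖ := by positivity
  simp only [matSize]
  nlinarith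

theorem matSize_nonneg (A : Matrix (Fin N) (Fin N) ℂ) : 0 ≤ matSize A := by
  unfold matSize
  positivity

theorem orderedProd_succ {n : ℕ} (H : Fin (n + 1) → HermMat N) :
    orderedProd H = (H 0 : Matrix (Fin N) (Fin N) ℂ) * orderedProd fun i => H i.succ := by
  simp [orderedProd, List.ofFn_succ]

theorem orderedProd_zero (H : Fin 0 → HermMat N) : orderedProd H = 1 := by
  simp [orderedProd]

theorem matSize_mul_orderedProd_le (A : Matrix (Fin N) (Fin N) ℂ) {n : ℕ}
    (H : Fin n → HermMat N) :
    matSize (A * orderedProd H) ≤ matSize A * ∏ i, matSize (H i : Matrix (Fin N) (Fin N) ℂ) := by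
  induction n generalizing A with
  | zero => simp [orderedProd_zero]
  | succ n ih =>
    rw [orderedProd_succ, ← Matrix.mul_assoc, Fin.prod_univ_succ, ← mul_assoc]
    exact (ih _ _).trans (mul_le_mul_of_nonneg_right (matSize_mul_le _ _)
      (Finset.prod_nonneg fun i _ => matSize_nonneg _))

/-- The Schur function is a polynomial in the entries of the matrix, hence bounded by a power of the
size. -/
theorem exists_norm_schur_le (N : ℕ) (lam : YoungDiagram) :
    ∃ (C : ℝ) (k : ℕ), 0 ≤ C ∧ ∀ A : Matrix (Fin N) (Fin N) ℂ,
      ‖schur lam A‖ ≤ C * matSize A ^ k := by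
  obtain ⟨q, hq⟩ := exists_eval_eq_schur N lam
  have h1 : ∀ p : Fin N × Fin N, PolyGrowth fun x : Fin N × Fin N → ℂ => x p := fun p =>
    ⟨continuous_apply p, 1, 1, fun x => by
      have := norm_le_pi_norm x p
      rw [pow_one, one_mul]
      linarith⟩
  obtain ⟨C, k, hC, h⟩ := (PolyGrowth.eval h1 q).exists_nonneg
  refine ⟨C, k, hC, fun A => ?_⟩
  rw [hq]
  refine (h _).trans (mul_le_mul_of_nonneg_left (pow_le_pow_left₀ (by positivity) ?_ k) hC)
  refine add_le_add le_rfl ((pi_norm_le_iff_of_nonneg (by positivity)).2 fun p => ?_)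
  rw [← Fintype.sum_prod_type' fun i j => ‖A i j‖]
  exact Finset.single_le_sum (f := fun p : Fin N × Fin N => ‖A p.1 p.2‖)
    (fun p _ => norm_nonneg _) (Finset.mem_univ p)

theorem integrable_matSize_pow (N k : ℕ) :
    Integrable (fun H : HermMat N => matSize (H : Matrix (Fin N) (Fin N) ℂ) ^ k) (gue N) := by
  rcases Nat.eq_zero_or_pos N with rfl | hN
  · simp [matSize]
  have : NeZero N := ⟨hN.ne'⟩
  have h1 : ∀ i j : Fin N, PolyGrowth fun c : HermCoord N => ((‖coordMatrix c i j‖ : ℝ) : ℂ) := by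
    intro i j
    obtain ⟨hc, C, k, h⟩ := polyGrowth_coordMatrix i j
    exact ⟨Complex.continuous_ofReal.comp hc.norm, C, k, fun c => by simpa using h c⟩
  have h2 : PolyGrowth fun c : HermCoord N =>
      ((1 : ℂ) + ∑ i, ∑ j, ((‖coordMatrix c i j‖ : ℝ) : ℂ)) ^ k :=
    ((PolyGrowth.const 1).add
      (PolyGrowth.sum fun i _ => PolyGrowth.sum fun j _ => h1 i j)).pow k
  have hcont : Continuous fun A : Matrix (Fin N) (Fin N) ℂ =>
      ((1 : ℂ) + ∑ i, ∑ j, ((‖A i j‖ : ℝ) : ℂ)) ^ k :=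
    (continuous_const.add (continuous_finsetSum _ fun i _ => continuous_finsetSum _ fun j _ =>
      Complex.continuous_ofReal.comp (continuous_id.matrix_elem i j).norm)).pow k
  refine (integrable_gue hcont h2).re.congr (Filter.Eventually.of_forall fun H => ?_)
  simp only [matSize]
  norm_cast

instance : SecondCountableTopology (HermMat N) :=
  have : SecondCountableTopology (Matrix (Fin N) (Fin N) ℂ) :=
    inferInstanceAs (SecondCountableTopology (Fin N → Fin N → ℂ))
  TopologicalSpace.Subtype.secondCountableTopology
    (selfAdjoint (Matrix (Fin N) (Fin N) ℂ) : Set (Matrix (Fin N) (Fin N) ℂ))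

theorem continuous_orderedProd (n : ℕ) :
    Continuous fun H : Fin n → HermMat N => orderedProd H := by
  induction n with
  | zero => simp only [orderedProd_zero]; exact continuous_const
  | succ n ih =>
    simp only [orderedProd_succ]
    exact (continuous_subtype_val.comp (continuous_apply 0)).mul
      (ih.comp (continuous_pi fun i => continuous_apply i.succ))

theorem integrable_schur_mul_orderedProd (lam : YoungDiagram) (A : Matrix (Fin N) (Fin N) ℂ)
    (n : ℕ) : Integrable (fun H : Fin n → HermMat N => schur lam (A * orderedProd H))
      (Measure.pi fun _ => gue N) := by
  obtain ⟨C, k, hC, h⟩ := exists_norm_schur_le N lam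
  have h1 : Integrable (fun H : Fin n → HermMat N =>
      ∏ i, matSize (H i : Matrix (Fin N) (Fin N) ℂ) ^ k) (Measure.pi fun _ => gue N) :=
    Integrable.fintype_prod fun _ => integrable_matSize_pow N k
  refine (h1.const_mul (C * matSize A ^ k)).mono' ((continuous_schur lam).comp
    (continuous_const.mul (continuous_orderedProd n))).aestronglyMeasurable
    (Filter.Eventually.of_forall fun H => (h _).trans ?_)
  rw [mul_assoc, Finset.prod_pow, ← mul_pow]
  exact mul_le_mul_of_nonneg_left (pow_le_pow_left₀ (matSize_nonneg _)
    (matSize_mul_orderedProd_le A H) k) hC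

/-- If averaging over one factor multiplies `s_λ` by `t`, averaging over `n` independent factors
multiplies it by `t ^ n`. -/
theorem integral_schur_mul_orderedProd {lam : YoungDiagram} {t : ℂ}
    (ht : ∀ A : Matrix (Fin N) (Fin N) ℂ,
      ∫ H : HermMat N, schur lam (A * (H : Matrix (Fin N) (Fin N) ℂ)) ∂(gue N) = t * schur lam A)
    (n : ℕ) (A : Matrix (Fin N) (Fin N) ℂ) :
    ∫ H : Fin n → HermMat N, schur lam (A * orderedProd H) ∂(Measure.pi fun _ => gue N) =
      t ^ n * schur lam A := by
  induction n generalizing A with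
  | zero => simp [orderedProd_zero]
  | succ n ih =>
    have hmp := measurePreserving_piFinSuccAbove (fun _ : Fin (n + 1) => gue N) 0
    let g : HermMat N × (Fin n → HermMat N) → ℂ := fun p =>
      schur lam (A * (p.1 : Matrix (Fin N) (Fin N) ℂ) * orderedProd p.2)
    have hg : (fun H : Fin (n + 1) → HermMat N => schur lam (A * orderedProd H)) =
        g ∘ MeasurableEquiv.piFinSuccAbove (fun _ : Fin (n + 1) => HermMat N) 0 := by
      funext H
      rw [orderedProd_succ, ← Matrix.mul_assoc]
      rfl
    have hint : Integrable g ((gue N).prod (Measure.pi fun _ => gue N)) := by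
      have h := integrable_schur_mul_orderedProd lam A (n + 1)
      rw [hg] at h
      exact (hmp.integrable_comp_emb (MeasurableEquiv.measurableEmbedding _)).1 h
    have h1 := hmp.integral_comp' g
    have h2 := integral_prod g hint
    rw [hg]
    refine (h1.trans h2).trans ?_
    simp only [g, ih]
    rw [integral_const_mul, ht]
    ring

/-- The algebra relating the eigenvalue `t` of the averaging operator to the mean `t * s`. It
includes the degenerate case `s = 0`. -/
theorem pow_mul_eq_zpow_mul (s t : ℂ) (n : ℕ) :
    t ^ n * s = s ^ (1 - (n : ℤ)) * (t * s) ^ n := by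
  rcases eq_or_ne s 0 with rfl | hs
  · rcases Nat.eq_zero_or_pos n with rfl | hn
    · simp
    · simp [hn.ne']
  · rw [zpow_sub₀ hs, zpow_one, zpow_natCast, mul_pow]
    field_simp

end Product

end HermitianProduct

end

theorem mainTheorem2 (N n : ℕ) (lam : YoungDiagram) :
    MeasureTheory.Integrable
      (fun H : HermitianProduct.HermMat N =>
        HermitianProduct.schur lam (H : Matrix (Fin N) (Fin N) ℂ))
      (HermitianProduct.gue N) ∧
    MeasureTheory.Integrable
      (fun H : Fin n → HermitianProduct.HermMat N =>
        HermitianProduct.schur lam (HermitianProduct.orderedProd H))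
      (MeasureTheory.Measure.pi fun _ : Fin n => HermitianProduct.gue N) ∧
    ∫ H : Fin n → HermitianProduct.HermMat N,
        HermitianProduct.schur lam (HermitianProduct.orderedProd H)
        ∂(MeasureTheory.Measure.pi fun _ : Fin n => HermitianProduct.gue N) =
      HermitianProduct.schur lam (1 : Matrix (Fin N) (Fin N) ℂ) ^ (1 - (n : ℤ)) *
        (∫ H : HermitianProduct.HermMat N,
          HermitianProduct.schur lam (H : Matrix (Fin N) (Fin N) ℂ)
          ∂(HermitianProduct.gue N)) ^ n := by
  obtain ⟨t, ht⟩ := HermitianProduct.exists_integral_schur_mul N lam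
  obtain ⟨C, k, hC, h⟩ := HermitianProduct.exists_norm_schur_le N lam
  refine ⟨?_, ?_, ?_⟩
  · exact ((HermitianProduct.integrable_matSize_pow N k).const_mul C).mono'
      ((HermitianProduct.continuous_schur lam).comp continuous_subtype_val).aestronglyMeasurable
      (Filter.Eventually.of_forall fun H => h _)
  · simpa only [Matrix.one_mul] using
      HermitianProduct.integrable_schur_mul_orderedProd lam (1 : Matrix (Fin N) (Fin N) ℂ) n
  · have h1 := HermitianProduct.integral_schur_mul_orderedProd ht n 1
    have h2 := ht 1
    simp only [Matrix.one_mul] at h1 h2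
    rw [h1, h2]
    exact HermitianProduct.pow_mul_eq_zpow_mul _ t n
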